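/- Let $1\le p\le n$ and let $G,F_1,\dots,F_p\in\mathbb{R}[X_1,\dots,X_n]$. Put $V:=\{F_1=0,\dots,F_p=0\}\subseteq\mathbb{C}^n$. For $S\subseteq\mathbb{C}^n$ and a polynomial $Q$ write $S_{\mathbb{R}}:=S\cap\mathbb{R}^n$ and $S_Q:=\{x\in S\mid Q(x)\neq0\}$. A point $x$ is called $(Q_1,\dots,Q_m)$-regular if the Jacobian $J(Q_1,\dots,Q_m)$ has rank $m$ at $x$. Assume that $V_{\mathbb{R}}\neq\emptyset$ and that every point of $V_{\mathbb{R}}$ is $(F_1,\dots,F_p)$-regular. An index sequence $\mathcal{J}$ is a sequence $1\le j_1<\dots<j_p\le n$. Let $\Delta_{\mathcal{J}}$ be the $p$-minor of $J(F_1,\dots,F_p)$ with columns $\mathcal{J}$, and let $M^{\mathcal{J}}_1,\dots,M^{\mathcal{J}}_{n-p}$ be the $(p+1)$-minors of $J(F_1,\dots,F_p,G)$ whose columns are those of $\mathcal{J}$ together with one further column $i$, where $i$ runs in increasing order through $\{1,\dots,n\}\setminus\mathcal{J}$. Let $W:=\{x\in V\mid \operatorname{rk} J(F_1,\dots,F_p,G)(x)\le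 p\}$, and for $1\le k\le n-p$ let $D_k$ be the union of all irreducible components of $W$ of dimension strictly larger than $n-p-k$. (Irreducible components are taken in the Zariski topology of $\mathbb{C}^n$.) At the points of the chart $(V_{\mathbb{R}})_{\Delta_{\mathcal{J}}}$ the functions $X_i$, $i\notin\mathcal{J}$, are local coordinates of $V_{\mathbb{R}}$; let $H_{\mathcal{J}}$ be the $(n-p)\times(n-p)$ Hessian matrix of second partial derivatives of $G|_{V_{\mathbb{R}}}$ in these coordinates. Condition B: for every index sequence $\mathcal{J}$ and every $1\le k\le n-p$, every point of $\left((V_{\mathbb{R}})_{\Delta_{\mathcal{J}}}\cap\{M^{\mathcal{J}}_1=0,\dots,M^{\mathcal{J}}_k=0\}\right)\setminus D_k$ is $(F_1,\dots,F_p,M^{\mathcal{J}}_1,\dots,M^{\mathcal{J}}_k)$-regular; every irreducible component of $\left(V_{\Delta_{\mathcal{J}}}\cap\{M^{\mathcal{J}}_1=0,\dots,M^{\mathcal{J}}_k=0\}\right)\setminus D_k$ contains a real point; and each irreducible component of $W$ has dimension strictly smaller than $n-p$ and contains a real point. Condition C: for every index sequence $\mathcal{J}$, $\det H_{\mathcal{J}}$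 does not vanish at any $(F_1,\dots,F_p,M^{\mathcal{J}}_1,\dots,M^{\mathcal{J}}_{n-p})$-regular real point of $W_{\Delta_{\mathcal{J}}}$. Suppose that Conditions B and C hold. Then, for every index sequence $\mathcal{J}$, the set of isolated local minimal points of $G$ on $(V_{\mathbb{R}})_{\Delta_{\mathcal{J}}}$ (local minimal points having a neighborhood that contains no other local minimal point) is exactly the set of $(F_1,\dots,F_p,M^{\mathcal{J}}_1,\dots,M^{\mathcal{J}}_{n-p})$-regular points of $(W_{\mathbb{R}})_{\Delta_{\mathcal{J}}}$ at which $H_{\mathcal{J}}$ is positive definite. -/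

import Mathlib

open Topology

noncomputable section

namespace PolyOpt

variable {n p : ℕ}

/-! ### Algebraic subsets of complex affine space -/

/-- The Zariski topology on `ℂⁿ`: the closed sets are the sets of common zeros of families of
polynomials, i.e. the topology induced from the prime spectrum of the polynomial ring. -/
@[reducible] def zariskiTopology (n : ℕ) : TopologicalSpace (Fin n → ℂ) :=
  TopologicalSpace.induced (MvPolynomial.pointToPoint (k := ℂ) (K := ℂ) (σ := Fin n))
    inferInstance

/-- `C` is irreducible for the Zariski topology (in particular non-empty). -/
def ZariskiIrreducible (C : Set (Fin n → ℂ)) : Prop :=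
  @IsIrreducible _ (zariskiTopology n) C

/-- `C` is an irreducible component of the set `S ⊆ ℂⁿ`: a maximal irreducible subset of `S`. -/
def IsComponentOf (C S : Set (Fin n → ℂ)) : Prop :=
  Maximal (fun T : Set (Fin n → ℂ) => T ⊆ S ∧ ZariskiIrreducible T) C

/-- The dimension of a Zariski closed set `C`: the Krull dimension of its coordinate ring. -/
def zariskiDim (C : Set (Fin n → ℂ)) : WithBot ℕ∞ :=
  ringKrullDim (MvPolynomial (Fin n) ℂ ⧸ MvPolynomial.vanishingIdeal ℂ C)

/-- The set of real points of a subset of `ℂⁿ`. -/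
def realTrace (S : Set (Fin n → ℂ)) : Set (Fin n → ℝ) :=
  {x | (fun i => (x i : ℂ)) ∈ S}

/-- The set of common complex zeros of a family of real polynomials. -/
def zeroSet {ι : Type*} (f : ι → MvPolynomial (Fin n) ℝ) : Set (Fin n → ℂ) :=
  {z | ∀ i, MvPolynomial.aeval z (f i) = 0}

/-- The set of points of `S` at which `Q` does not vanish. -/
def localized (S : Set (Fin n → ℂ)) (Q : MvPolynomial (Fin n) ℝ) : Set (Fin n → ℂ) :=
  {z | z ∈ S ∧ MvPolynomial.aeval z Q ≠ 0}

/-! ### Jacobians and minors -/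

/-- The Jacobian matrix of a family of polynomials. -/
def jacobian {ι : Type*} (f : ι → MvPolynomial (Fin n) ℝ) :
    Matrix ι (Fin n) (MvPolynomial (Fin n) ℝ) :=
  Matrix.of fun i l => MvPolynomial.pderiv l (f i)

/-- The value of the Jacobian matrix at a real or complex point. -/
def jacobianAt {ι : Type*} {K : Type*} [Field K] [Algebra ℝ K]
    (f : ι → MvPolynomial (Fin n) ℝ) (z : Fin n → K) : Matrix ι (Fin n) K :=
  (jacobian f).map (MvPolynomial.aeval z)

/-- The real point `x` is regular for the finite family `f`: the Jacobian of `f` has maximal rank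
(the number of members of `f`) at `x`. -/
def IsRegularAt {ι : Type*} [Fintype ι] (f : ι → MvPolynomial (Fin n) ℝ) (x : Fin n → ℝ) : Prop :=
  (jacobianAt f x).rank = Fintype.card ι

/-- The family `F_1, …, F_p, G`. -/
def withObjective (F : Fin p → MvPolynomial (Fin n) ℝ) (G : MvPolynomial (Fin n) ℝ) :
    Fin (p + 1) → MvPolynomial (Fin n) ℝ :=
  Fin.snoc (α := fun _ => MvPolynomial (Fin n) ℝ) F G

/-- The set `W` of points of `V` at which the Jacobian of `F_1, …, F_p, G` has rank at most `p`. -/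
def criticalSet (F : Fin p → MvPolynomial (Fin n) ℝ) (G : MvPolynomial (Fin n) ℝ) :
    Set (Fin n → ℂ) :=
  {z | z ∈ zeroSet F ∧ (jacobianAt (withObjective F G) z).rank ≤ p}

/-- An index sequence `J`, i.e. `j_1 < ⋯ < j_p`, is an order embedding `Fin p ↪o Fin n`. -/
theorem card_compl (J : Fin p ↪o Fin n) :
    ((Finset.univ.map J.toEmbedding)ᶜ : Finset (Fin n)).card = n - p := by
  simp [Finset.card_compl]

/-- The increasing enumeration of the indices that do not belong to `J`. -/
def complSeq (J : Fin p ↪o Fin n) : Fin (n - p) ↪o Fin n :=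
  ((Finset.univ.map J.toEmbedding)ᶜ : Finset (Fin n)).orderEmbOfFin (card_compl J)

/-- The minor `Δ_J` of the Jacobian of `F` with columns `J`. -/
def Δ (F : Fin p → MvPolynomial (Fin n) ℝ) (J : Fin p ↪o Fin n) : MvPolynomial (Fin n) ℝ :=
  ((jacobian F).submatrix id J).det

/-- The `(p+1)`-minors `M^J_1, …, M^J_{n-p}` of the Jacobian of `F_1, …, F_p, G`: the columns are
those of `J` and one further column, which is placed last (this only affects the sign). -/
def M (F : Fin p → MvPolynomial (Fin n) ℝ) (G : MvPolynomial (Fin n) ℝ) (J : Fin p ↪o Fin n)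
    (i : Fin (n - p)) : MvPolynomial (Fin n) ℝ :=
  ((jacobian (withObjective F G)).submatrix id
    (Fin.snoc (α := fun _ => Fin n) J (complSeq J i))).det

/-- The family `F_1, …, F_p, M^J_1, …, M^J_k`. -/
def withMinors (F : Fin p → MvPolynomial (Fin n) ℝ) (G : MvPolynomial (Fin n) ℝ)
    (J : Fin p ↪o Fin n) (k : ℕ) (hk : k ≤ n - p) : Fin p ⊕ Fin k → MvPolynomial (Fin n) ℝ :=
  Sum.elim F fun i => M F G J (Fin.castLE hk i)

/-! ### The Hessian of `G` on the chart `Δ_J ≠ 0` -/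

/-- On the chart `Δ_J ≠ 0` the coordinates `x_i`, `i ∉ J`, are local coordinates of the level sets
of `F`. This is the `i`-th coordinate vector field for them: the vector with component `1` at the
`i`-th index outside `J`, with component `0` at the other indices outside `J`, and annihilated by
the Jacobian of `F`. -/
def coordField (F : Fin p → MvPolynomial (Fin n) ℝ) (J : Fin p ↪o Fin n) (i : Fin (n - p))
    (x : Fin n → ℝ) : Fin n → ℝ :=
  Pi.single (complSeq J i) 1 -
    ∑ j : Fin p, (((jacobianAt F x).submatrix id J)⁻¹.mulVec
      fun l => jacobianAt F x l (complSeq J i)) j • Pi.single (J j) 1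

/-- The partial derivative of `g` with respect to the `i`-th local coordinate. -/
def coordDeriv (F : Fin p → MvPolynomial (Fin n) ℝ) (J : Fin p ↪o Fin n) (i : Fin (n - p))
    (g : (Fin n → ℝ) → ℝ) (x : Fin n → ℝ) : ℝ :=
  fderiv ℝ g x (coordField F J i x)

/-- The Hessian matrix `H_J` of `G` at a real point of the chart `Δ_J ≠ 0`: the matrix of second
partial derivatives of `G` in the local coordinates `x_i`, `i ∉ J`. -/
def hessian (F : Fin p → MvPolynomial (Fin n) ℝ) (G : MvPolynomial (Fin n) ℝ) (J : Fin p ↪o Fin n)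
    (x : Fin n → ℝ) : Matrix (Fin (n - p)) (Fin (n - p)) ℝ :=
  Matrix.of fun i l =>
    coordDeriv F J i (coordDeriv F J l fun y => MvPolynomial.eval y G) x

/-! ### The two conditions -/

/-- The union `D_k` of all irreducible components of `W` of dimension larger than `n - p - k`. -/
def D (F : Fin p → MvPolynomial (Fin n) ℝ) (G : MvPolynomial (Fin n) ℝ) (k : ℕ) :
    Set (Fin n → ℂ) :=
  ⋃₀ {C | IsComponentOf C (criticalSet F G) ∧ ((n - p - k : ℕ) : WithBot ℕ∞) < zariskiDim C}

/-- The set of points of `V` with `Δ_J ≠ 0` and `M^J_1 = ⋯ = M^J_k = 0` outside `D_k`. -/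
def stratum (F : Fin p → MvPolynomial (Fin n) ℝ) (G : MvPolynomial (Fin n) ℝ)
    (J : Fin p ↪o Fin n) (k : ℕ) (hk : k ≤ n - p) : Set (Fin n → ℂ) :=
  localized (zeroSet (withMinors F G J k hk)) (Δ F J) \ D F G k

/-- Condition B. -/
def ConditionB (F : Fin p → MvPolynomial (Fin n) ℝ) (G : MvPolynomial (Fin n) ℝ) : Prop :=
  ∀ (J : Fin p ↪o Fin n) (k : ℕ) (hk : k ≤ n - p), 1 ≤ k →
    (∀ x ∈ realTrace (stratum F G J k hk), IsRegularAt (withMinors F G J k hk) x) ∧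
    (∀ C, IsComponentOf C (stratum F G J k hk) → (realTrace C).Nonempty) ∧
    (∀ C, IsComponentOf C (criticalSet F G) →
      zariskiDim C < ((n - p : ℕ) : WithBot ℕ∞) ∧ (realTrace C).Nonempty)

/-- Condition C. -/
def ConditionC (F : Fin p → MvPolynomial (Fin n) ℝ) (G : MvPolynomial (Fin n) ℝ) : Prop :=
  ∀ (J : Fin p ↪o Fin n), ∀ x ∈ realTrace (localized (criticalSet F G) (Δ F J)),
    IsRegularAt (withMinors F G J (n - p) le_rfl) x → (hessian F G J x).det ≠ 0

/-- `x` is an isolated local minimal point of `g` on `S`: a local minimal point with a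
neighbourhood in `S` that contains no other local minimal point. -/
def IsIsolatedLocalMinOn (g : (Fin n → ℝ) → ℝ) (S : Set (Fin n → ℝ)) (x : Fin n → ℝ) : Prop :=
  x ∈ S ∧ IsLocalMinOn g S x ∧ ∀ᶠ y in 𝓝[S] x, IsLocalMinOn g S y → y = x

end PolyOpt

end

/-! ### Derivations of function fields and dimension -/

namespace PolyOpt

/-! On the chart where `Δ F J` is nonzero, a point of `V` is critical for `G` exactly when Lagrange
multipliers `c` exist, and exactly when all minors `M F G J i` vanish. At such a point `hessian F G
J x` is the second derivative of the Lagrangian `G - ∑ c_j F_j`, restricted to the tangent space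
(`hessian_apply`). A local minimum therefore has a positive semidefinite Hessian, and a critical
point with positive definite Hessian is a local minimum.

If a critical point is regular for the `n` polynomials `F`, `M`, it is isolated among their common
zeros (`eventually_eq_of_isRegularAt`), hence among the local minima. Conversely, once regularity at
an isolated local minimum is known, Condition C upgrades semidefinite to definite.

The remaining point is this regularity. By Condition B it suffices that an isolated local minimum
`x` avoids `D F G (n - p)` (`not_mem_D_of_isIsolatedLocalMinOn`). Otherwise `x` lies on a component
`C` of `W` of dimension at least `n - p - m` and outside `D F G m`, for some `1 ≤ m < n - p`, so
Condition B makes `F, M_1, …, M_m` regular at `x`. These are `p + m` equations vanishing on `C`,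
whose dimension is at least `n - (p + m)`. A count of derivations of the function field of `C` shows
that polynomial fields tangent to the equations preserve the ideal of `C`
(`sum_mul_pderiv_mem_of_isPrime`). The real integral curve of such a field through `x` thus stays in
the zero set of that ideal. It consists of critical points, `G` is constant on it, and its points
near `x` are again local minima: `x` is not isolated. -/

/-- Incomparability: contraction along an integral extension keeps chains of primes strict.
Injectivity is not needed for this inequality. -/
theorem ringKrullDim_le_of_isIntegral {A B : Type*} [CommRing A] [CommRing B] [Algebra B A]
    [Algebra.IsIntegral B A] : ringKrullDim A ≤ ringKrullDim B :=
  Order.krullDim_le_of_strictMono (PrimeSpectrum.comap (algebraMap B A)) fun I J h => by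
    have : I.asIdeal < J.asIdeal := h
    exact Ideal.IsIntegral.comap_lt_comap (R := B) this

open KaehlerDifferential in
-- Localization is formally étale, and so is an algebraic extension of fields in characteristic
-- zero. Hence `Ω[K⁄k]` is the base change of the free module on the `dX_i`.
theorem finrank_kaehlerDifferential_of_isAlgebraic_mvPolynomial {k K : Type*} {s : ℕ}
    [Field k] [Field K] [CharZero k]
    [Algebra k K] [Algebra (MvPolynomial (Fin s) k) K] [IsScalarTower k (MvPolynomial (Fin s) k) K]
    [FaithfulSMul (MvPolynomial (Fin s) k) K] [Algebra.IsAlgebraic (MvPolynomial (Fin s) k) K] :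
    Module.finrank K (Ω[K⁄k]) = s := by
  let L := FractionRing (MvPolynomial (Fin s) k)
  let : Algebra L K := FractionRing.liftAlgebra (MvPolynomial (Fin s) k) K
  have : IsScalarTower (MvPolynomial (Fin s) k) L K :=
    FractionRing.isScalarTower_liftAlgebra (MvPolynomial (Fin s) k) K
  have : Algebra.IsAlgebraic L K :=
    (IsFractionRing.comap_isAlgebraic_iff (A := MvPolynomial (Fin s) k)).mp inferInstance
  have : CharZero L := charZero_of_injective_algebraMap (algebraMap k L).injective
  have : Algebra.FormallyEtale (MvPolynomial (Fin s) k) L :=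
    .of_isLocalization (nonZeroDivisors (MvPolynomial (Fin s) k))
  have : Algebra.FormallyEtale L K := .of_isSeparable L K
  have : Algebra.FormallyEtale (MvPolynomial (Fin s) k) K :=
    .comp (MvPolynomial (Fin s) k) L K
  have e := tensorKaehlerEquivOfFormallyEtale k (MvPolynomial (Fin s) k) K
  rw [← e.finrank_eq, Module.finrank_baseChange,
    Module.finrank_eq_card_basis (mvPolynomialBasis k (Fin s)), Fintype.card_fin]

theorem finrank_derivation_of_isAlgebraic_mvPolynomial {k K : Type*} {s : ℕ}
    [Field k] [Field K] [CharZero k]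
    [Algebra k K] [Algebra (MvPolynomial (Fin s) k) K] [IsScalarTower k (MvPolynomial (Fin s) k) K]
    [FaithfulSMul (MvPolynomial (Fin s) k) K] [Algebra.IsAlgebraic (MvPolynomial (Fin s) k) K] :
    Module.finrank K (Derivation k K K) = s := by
  rw [← (KaehlerDifferential.linearMapEquivDerivation k K (M := K)).finrank_eq]
  exact (Subspace.dual_finrank_eq (K := K)).trans
    (finrank_kaehlerDifferential_of_isAlgebraic_mvPolynomial)

/-- Noether normalization makes `A` integral over a polynomial ring in `s` variables. Then `s`
bounds the dimension and equals the number of independent derivations. -/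
theorem ringKrullDim_le_finrank_derivation {k A : Type*} [Field k] [CharZero k] [CommRing A]
    [IsDomain A] [Algebra k A] [Algebra.FiniteType k A] :
    ringKrullDim A ≤ Module.finrank (FractionRing A)
      (Derivation k (FractionRing A) (FractionRing A)) := by
  obtain ⟨s, g, hinj, hint⟩ := exists_integral_inj_algHom_of_fg k A
  algebraize [g.toRingHom]
  have : Algebra.IsIntegral (MvPolynomial (Fin s) k) A := ⟨hint⟩
  have : FaithfulSMul (MvPolynomial (Fin s) k) A :=
    (faithfulSMul_iff_algebraMap_injective _ _).mpr hinj
  have : IsScalarTower k (MvPolynomial (Fin s) k) A := .of_algebraMap_eq' (by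
    ext x; exact (g.commutes x).symm)
  have : FaithfulSMul (MvPolynomial (Fin s) k) (FractionRing A) :=
    FaithfulSMul.trans (MvPolynomial (Fin s) k) A (FractionRing A)
  have : Algebra.IsAlgebraic A (FractionRing A) :=
    (IsFractionRing.comap_isAlgebraic_iff (A := A) (K := FractionRing A)).mpr inferInstance
  have : Algebra.IsAlgebraic (MvPolynomial (Fin s) k) (FractionRing A) :=
    Algebra.IsAlgebraic.trans _ A _
  rw [finrank_derivation_of_isAlgebraic_mvPolynomial (s := s)]
  refine (ringKrullDim_le_of_isIntegral (B := MvPolynomial (Fin s) k)).trans ?_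
  rw [MvPolynomial.ringKrullDim_of_isNoetherianRing]
  simp [ringKrullDim_eq_zero_of_field]

theorem derivation_algebraMap_mvPolynomial {k K : Type*} {n : ℕ} [Field k] [Field K] [Algebra k K]
    [Algebra (MvPolynomial (Fin n) k) K] [IsScalarTower k (MvPolynomial (Fin n) k) K]
    (D : Derivation k K K) (g : MvPolynomial (Fin n) k) :
    D (algebraMap (MvPolynomial (Fin n) k) K g) =
      ∑ l, algebraMap (MvPolynomial (Fin n) k) K (MvPolynomial.pderiv l g) *
      D (algebraMap (MvPolynomial (Fin n) k) K (MvPolynomial.X l)) := by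
  induction g using MvPolynomial.induction_on with
  | C a =>
    have : algebraMap (MvPolynomial (Fin n) k) K (MvPolynomial.C a) = algebraMap k K a :=
      (IsScalarTower.algebraMap_apply k (MvPolynomial (Fin n) k) K a).symm
    simp [this]
  | add p q hp hq => simp [hp, hq, add_mul, Finset.sum_add_distrib]
  | mul_X p i hp =>
    simp only [map_mul, Derivation.leibniz, hp, smul_eq_mul, MvPolynomial.pderiv_X, map_add,
      add_mul, Finset.sum_add_distrib, Finset.mul_sum]
    congr 1
    · rw [Finset.sum_eq_single i]
      · simp
      · intro b _ hb
        simp [Ne.symm hb]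
      · simp
    · exact Finset.sum_congr rfl fun l _ => by ring

/-- Let `P` be a prime ideal containing a family `f` whose Jacobian has a minor outside `P`. If the
dimension of the quotient by `P` is the expected one, then every polynomial vector field which is
tangent to `f = 0` modulo `P` preserves `P`. -/
theorem sum_mul_pderiv_mem_of_isPrime {k ι : Type*} {n : ℕ} [Field k] [CharZero k] [Fintype ι]
    [DecidableEq ι] (P : Ideal (MvPolynomial (Fin n) k)) [P.IsPrime]
    (f : ι → MvPolynomial (Fin n) k) (hf : ∀ i, f i ∈ P) (S : ι → Fin n)
    (hS : (Matrix.of fun i j => MvPolynomial.pderiv (S j) (f i)).det ∉ P)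
    (hdim : ((n - Fintype.card ι : ℕ) : WithBot ℕ∞) ≤ ringKrullDim (MvPolynomial (Fin n) k ⧸ P))
    (v : Fin n → MvPolynomial (Fin n) k)
    (hv : ∀ i, ∑ l, v l * MvPolynomial.pderiv l (f i) ∈ P)
    {g : MvPolynomial (Fin n) k} (hg : g ∈ P) : ∑ l, v l * MvPolynomial.pderiv l g ∈ P := by
  let K := FractionRing (MvPolynomial (Fin n) k ⧸ P)
  have hker : ∀ q : MvPolynomial (Fin n) k,
      algebraMap (MvPolynomial (Fin n) k) K q = 0 ↔ q ∈ P := fun q => by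
    rw [IsScalarTower.algebraMap_apply _ (MvPolynomial (Fin n) k ⧸ P) K,
      FaithfulSMul.algebraMap_eq_zero_iff]
    exact Ideal.Quotient.eq_zero_iff_mem
  let A : Matrix ι (Fin n) K :=
    Matrix.of fun i l => algebraMap (MvPolynomial (Fin n) k) K (MvPolynomial.pderiv l (f i))
  have hrank : Fintype.card ι ≤ A.rank := by
    have hdet : (A.submatrix id S).det ≠ 0 := by
      intro h0
      refine hS ((hker _).mp ?_)
      rw [RingHom.map_det, ← h0]
      rfl
    rw [← Matrix.rank_of_det_ne_zero hdet]
    exact Matrix.rank_submatrix_le A id S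
  -- A derivation is recorded by its values on the coordinates. It is determined by them because `K`
  -- consists of quotients of polynomials in the coordinates.
  let Φ : Derivation k K K →ₗ[K] (Fin n → K) :=
    { toFun := fun D l => D (algebraMap (MvPolynomial (Fin n) k) K (MvPolynomial.X l))
      map_add' := fun _ _ => rfl
      map_smul' := fun _ _ => rfl }
  have hΦ : Function.Injective Φ := by
    rw [injective_iff_map_eq_zero]
    intro D hD
    have hD' : ∀ q : MvPolynomial (Fin n) k,
        D (algebraMap (MvPolynomial (Fin n) k) K q) = 0 := fun q => by
      rw [derivation_algebraMap_mvPolynomial]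
      exact Finset.sum_eq_zero fun l _ => by
        rw [show D (algebraMap (MvPolynomial (Fin n) k) K (MvPolynomial.X l)) = 0 from
          congrFun hD l, mul_zero]
    ext x
    obtain ⟨a, b, hb, rfl⟩ := IsFractionRing.div_surjective (A := MvPolynomial (Fin n) k ⧸ P) x
    obtain ⟨a, rfl⟩ := Ideal.Quotient.mk_surjective a
    obtain ⟨b, rfl⟩ := Ideal.Quotient.mk_surjective b
    have ha := hD' a
    have hb' := hD' b
    rw [IsScalarTower.algebraMap_apply _ (MvPolynomial (Fin n) k ⧸ P) K] at ha hb'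
    erw [Derivation.leibniz_div, ha, hb']
    simp
  -- Each `f i` is zero in `K`, so the chain rule makes these values a kernel vector of the
  -- Jacobian.
  have hrange : LinearMap.range Φ ≤ LinearMap.ker A.mulVecLin := by
    rintro _ ⟨D, rfl⟩
    ext i
    have := derivation_algebraMap_mvPolynomial D (f i)
    rw [(hker _).mpr (hf i), map_zero] at this
    exact this.symm
  -- The kernel has dimension at most `n - card ι`, while the dimension hypothesis supplies at least
  -- that many derivations. So every kernel vector comes from a derivation.
  have hfin : Module.finrank K (LinearMap.ker A.mulVecLin) ≤
      Module.finrank K (LinearMap.range Φ) := by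
    have h1 := LinearMap.finrank_range_add_finrank_ker A.mulVecLin
    rw [LinearMap.finrank_range_of_inj hΦ]
    have h2 := hdim.trans (ringKrullDim_le_finrank_derivation (k := k)
      (A := MvPolynomial (Fin n) k ⧸ P))
    have h3 : n - Fintype.card ι ≤ Module.finrank K (Derivation k K K) := by exact_mod_cast h2
    rw [Module.finrank_fin_fun] at h1
    have : A.rank = Module.finrank K (LinearMap.range A.mulVecLin) := rfl
    omega
  have heq := Submodule.eq_of_le_of_finrank_le hrange hfin
  have hvker : (fun l => algebraMap (MvPolynomial (Fin n) k) K (v l)) ∈ LinearMap.ker A.mulVecLin := by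
    ext i
    have := (hker _).mpr (hv i)
    simp only [map_sum, map_mul] at this
    simpa [Matrix.mulVec, dotProduct, A, mul_comm] using this
  rw [← heq] at hvker
  -- The field `v` is now a derivation of `K`, which kills the zero class of `g`.
  obtain ⟨D, hD⟩ := hvker
  rw [← hker, map_sum]
  have hDg := derivation_algebraMap_mvPolynomial D g
  rw [(hker _).mpr hg, map_zero] at hDg
  rw [hDg]
  refine Finset.sum_congr rfl fun l _ => ?_
  rw [map_mul, mul_comm, ← show D (algebraMap (MvPolynomial (Fin n) k) K (MvPolynomial.X l)) =
    algebraMap (MvPolynomial (Fin n) k) K (v l) from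
    congrFun hD l]

end PolyOpt

/-! ### Tangent fields from Cramer's rule, critical points and multipliers -/

namespace PolyOpt

open MvPolynomial

variable {n p : ℕ}

theorem isPrime_vanishingIdeal {C : Set (Fin n → ℂ)} (hC : ZariskiIrreducible C) :
    (vanishingIdeal ℂ C).IsPrime := by
  let := zariskiTopology n
  rw [← vanishingIdeal_pointToPoint, ← PrimeSpectrum.isIrreducible_iff_vanishingIdeal_isPrime]
  exact IsIrreducible.image hC _ continuous_induced_dom.continuousOn

theorem exists_submatrix_det_ne_zero {K ι : Type*} [Field K] [Fintype ι] [DecidableEq ι]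
    (A : Matrix ι (Fin n) K) (hA : A.rank = Fintype.card ι) :
    ∃ S : ι → Fin n, (A.submatrix id S).det ≠ 0 := by
  rw [Matrix.rank_eq_finrank_span_cols] at hA
  obtain ⟨f, hf, -, hli⟩ := Submodule.exists_fun_fin_finrank_span_eq K (Set.range A.col)
  choose S hS using hf
  let e : ι ≃ Fin (Module.finrank K (Submodule.span K (Set.range A.col))) :=
    (Fintype.equivFin ι).trans (finCongr hA.symm)
  refine ⟨S ∘ e, fun h0 => ?_⟩
  have h1 : LinearIndependent K (A.submatrix id (S ∘ e)).col := by
    have : (A.submatrix id (S ∘ e)).col = f ∘ e := by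
      funext j
      exact hS (e j)
    rw [this]
    exact hli.comp _ e.injective
  rw [Matrix.linearIndependent_cols_iff_isUnit, Matrix.isUnit_iff_isUnit_det, h0] at h1
  exact not_isUnit_zero h1

/-- The polynomial vector field with component `det` of the columns `S` in direction `i`, which
annihilates all members of `f`, obtained by Cramer's rule. -/
def tangentField {R ι : Type*} [CommRing R] [Fintype ι] [DecidableEq ι]
    (A : Matrix ι (Fin n) R) (S : ι → Fin n) (i : Fin n) : Fin n → R :=
  Pi.single i (A.submatrix id S).det -
    ∑ j, Pi.single (S j) (((A.submatrix id S).adjugate.mulVec fun l => A l i) j)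

theorem sum_tangentField_mul {R ι : Type*} [CommRing R] [Fintype ι] [DecidableEq ι]
    (A : Matrix ι (Fin n) R) (S : ι → Fin n) (i : Fin n) (w : Fin n → R) :
    ∑ l, tangentField A S i l * w l = (A.submatrix id S).det * w i -
      ∑ j, ((A.submatrix id S).adjugate.mulVec fun l => A l i) j * w (S j) := by
  have hs : ∀ (a : Fin n) (c : R), ∑ l, (Pi.single a c : Fin n → R) l * w l = c * w a := by
    intro a c
    rw [Finset.sum_eq_single a] <;> simp +contextual
  simp only [tangentField, Pi.sub_apply, Finset.sum_apply, sub_mul, Finset.sum_sub_distrib, hs,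
    Finset.sum_mul]
  rw [Finset.sum_comm]
  simp only [hs]

/-- The product of the square block with its adjugate is its determinant. No division occurs, so
tangency is an identity over the whole ring, not only where the minor is nonzero. -/
theorem sum_tangentField_mul_row {R ι : Type*} [CommRing R] [Fintype ι] [DecidableEq ι]
    (A : Matrix ι (Fin n) R) (S : ι → Fin n) (i : Fin n) (r : ι) :
    ∑ l, tangentField A S i l * A r l = 0 := by
  rw [sum_tangentField_mul]
  have h : (A.submatrix id S).mulVec ((A.submatrix id S).adjugate.mulVec fun l => A l i) =
      (A.submatrix id S).det • fun l => A l i := by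
    rw [Matrix.mulVec_mulVec, Matrix.mul_adjugate, Matrix.smul_mulVec, Matrix.one_mulVec]
  have := congrFun h r
  simp only [Matrix.mulVec, dotProduct, Matrix.submatrix_apply, id, Pi.smul_apply,
    smul_eq_mul] at this
  rw [← this, sub_eq_zero]
  exact Finset.sum_congr rfl fun j _ => mul_comm _ _

theorem tangentField_apply_self {R ι : Type*} [CommRing R] [Fintype ι] [DecidableEq ι]
    (A : Matrix ι (Fin n) R) (S : ι → Fin n) (i : Fin n) (hi : i ∉ Set.range S) :
    tangentField A S i i = (A.submatrix id S).det := by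
  have : ∀ j, i ≠ S j := fun j h => hi ⟨j, h.symm⟩
  simp [tangentField, this]

theorem map_tangentField {R R' ι : Type*} [CommRing R] [CommRing R'] [Fintype ι] [DecidableEq ι]
    (φ : R →+* R') (A : Matrix ι (Fin n) R) (S : ι → Fin n) (i l : Fin n) :
    φ (tangentField A S i l) = tangentField (A.map φ) S i l := by
  have h1 : φ (A.submatrix id S).det = ((A.map φ).submatrix id S).det := by
    rw [RingHom.map_det]; rfl
  have h2 : ∀ j, φ (((A.submatrix id S).adjugate.mulVec fun l => A l i) j) =
      (((A.map φ).submatrix id S).adjugate.mulVec fun l => (A.map φ) l i) j := fun j => by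
    rw [RingHom.map_mulVec, ← RingHom.mapMatrix_apply, RingHom.map_adjugate]; rfl
  have h3 : ∀ (a : Fin n) (c : R), φ ((Pi.single a c : Fin n → R) l) =
      (Pi.single a (φ c) : Fin n → R') l := fun a c => by
    simp only [Pi.single_apply]; split_ifs <;> simp
  simp only [tangentField, Pi.sub_apply, Finset.sum_apply, map_sub, map_sum, h1, h2, h3]

/-! ### Critical points -/

theorem aeval_ofReal (x : Fin n → ℝ) (q : MvPolynomial (Fin n) ℝ) :
    aeval (fun i => (x i : ℂ)) q = ((eval x q : ℝ) : ℂ) :=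
  aeval_algebraMap_apply (A := ℝ) ℂ x q

theorem eval_map_ofReal (x : Fin n → ℝ) (q : MvPolynomial (Fin n) ℝ) :
    eval (fun i => (x i : ℂ)) (map (algebraMap ℝ ℂ) q) = ((eval x q : ℝ) : ℂ) := by
  rw [← aeval_ofReal, eval_map, aeval_def]

variable (F : Fin p → MvPolynomial (Fin n) ℝ) (G : MvPolynomial (Fin n) ℝ) (J : Fin p ↪o Fin n)

theorem mem_realTrace_chart {x : Fin n → ℝ} :
    x ∈ realTrace (localized (zeroSet F) (Δ F J)) ↔ (∀ j, eval x (F j) = 0) ∧ eval x (Δ F J) ≠ 0 := by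
  simp [realTrace, localized, zeroSet, aeval_ofReal]

theorem aeval_M_eq_zero_of_mem_criticalSet {z : Fin n → ℂ} (hz : z ∈ criticalSet F G)
    (i : Fin (n - p)) : aeval z (M F G J i) = 0 := by
  by_contra h
  have hdet : aeval z (M F G J i) = ((jacobianAt (withObjective F G) z).submatrix id
      (Fin.snoc (α := fun _ => Fin n) J (complSeq J i))).det := by
    rw [M, AlgHom.map_det]; rfl
  rw [hdet] at h
  have h1 := Matrix.rank_of_det_ne_zero h
  have h2 := Matrix.rank_submatrix_le (jacobianAt (withObjective F G) z) id
    (Fin.snoc (α := fun _ => Fin n) J (complSeq J i))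
  have h3 := hz.2
  rw [h1, Fintype.card_fin] at h2
  omega

theorem exists_eq_or_eq_complSeq (l : Fin n) : (∃ j, l = J j) ∨ ∃ i, l = complSeq J i := by
  by_cases h : l ∈ Finset.univ.map J.toEmbedding
  · left
    simpa [eq_comm] using h
  · right
    have : l ∈ Set.range (complSeq J) := by
      rw [complSeq, Finset.range_orderEmbOfFin]
      simpa using h
    obtain ⟨i, hi⟩ := this
    exact ⟨i, hi.symm⟩

theorem complSeq_ne (i : Fin (n - p)) (j : Fin p) : complSeq J i ≠ J j := by
  have : complSeq J i ∈ (Finset.univ.map J.toEmbedding)ᶜ := Finset.orderEmbOfFin_mem _ _ i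
  intro h
  rw [h] at this
  simp at this

/-- `x` is a Lagrange critical point with multipliers `c`. -/
def IsMultiplier (x : Fin n → ℝ) (c : Fin p → ℝ) : Prop :=
  ∀ l, eval x (pderiv l G) = ∑ j, c j * eval x (pderiv l (F j))

/-- The invertible block of columns `J` forces the multipliers `c`. A vanishing minor gives a row
relation whose `J` columns make it a multiple of the one defined by `c`; its last column then yields
the multiplier equation at `complSeq J i`. Hence the `n - p` minors containing `J` suffice. -/
theorem exists_isMultiplier_of_M_eq_zero {x : Fin n → ℝ} (hΔ : eval x (Δ F J) ≠ 0)
    (hM : ∀ i, eval x (M F G J i) = 0) : ∃ c, IsMultiplier F G x c := by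
  let A := (jacobianAt F x).submatrix id J
  have hA : A.det ≠ 0 := by
    have : eval x (Δ F J) = A.det := by rw [Δ, RingHom.map_det]; rfl
    rwa [this] at hΔ
  have hAu : IsUnit A.det := hA.isUnit
  let c : Fin p → ℝ := Matrix.vecMul (fun j => eval x (pderiv (J j) G)) A⁻¹
  have hc : Matrix.vecMul c A = fun j => eval x (pderiv (J j) G) := by
    rw [Matrix.vecMul_vecMul, Matrix.nonsing_inv_mul _ hAu, Matrix.vecMul_one]
  refine ⟨c, fun l => ?_⟩
  obtain ⟨j, rfl⟩ | ⟨i, rfl⟩ := exists_eq_or_eq_complSeq J l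
  · exact (congrFun hc j).symm
  have hdet : eval x (M F G J i) = ((jacobianAt (withObjective F G) x).submatrix id
      (Fin.snoc (α := fun _ => Fin n) J (complSeq J i))).det := by
    rw [M, RingHom.map_det]; rfl
  obtain ⟨w, hw0, hw⟩ := Matrix.exists_vecMul_eq_zero_iff.mpr (hdet ▸ hM i)
  have hrow : ∀ l, ∑ j : Fin p, w j.castSucc * eval x (pderiv l (F j)) +
      w (Fin.last p) * eval x (pderiv l G) =
        ∑ r, w r * jacobianAt (withObjective F G) x r l := by
    intro l
    rw [Fin.sum_univ_castSucc]
    simp [jacobianAt, jacobian, withObjective]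
  have h1 : ∀ j : Fin p, ∑ j', w (Fin.castSucc j') * eval x (pderiv (J j) (F j')) +
      w (Fin.last p) * eval x (pderiv (J j) G) = 0 := fun j => by
    rw [hrow]
    simpa [Matrix.vecMul, dotProduct] using congrFun hw j.castSucc
  have h2 : ∑ j, w (Fin.castSucc j) * eval x (pderiv (complSeq J i) (F j)) +
      w (Fin.last p) * eval x (pderiv (complSeq J i) G) = 0 := by
    rw [hrow]
    simpa [Matrix.vecMul, dotProduct] using congrFun hw (Fin.last p)
  have h3 : (fun j : Fin p => w j.castSucc) = -(w (Fin.last p)) • c := by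
    have h4 : Matrix.vecMul (fun j : Fin p => w j.castSucc) A =
        Matrix.vecMul (-(w (Fin.last p)) • c) A := by
      rw [Matrix.smul_vecMul, hc]
      funext j
      have h5 : Matrix.vecMul (fun j : Fin p => w j.castSucc) A j =
        ∑ j', w (Fin.castSucc j') * eval x (pderiv (J j) (F j')) := rfl
      rw [h5, Pi.smul_apply, smul_eq_mul]
      linarith [h1 j]
    have h6 := congrArg (fun u => Matrix.vecMul u A⁻¹) h4
    simpa only [Matrix.vecMul_vecMul, Matrix.mul_nonsing_inv _ hAu, Matrix.vecMul_one] using h6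
  have hwl : w (Fin.last p) ≠ 0 := by
    intro h0
    rw [h0, neg_zero, zero_smul] at h3
    refine hw0 (funext fun r => ?_)
    induction r using Fin.lastCases with
    | last => exact h0
    | cast j => exact congrFun h3 j
  have h7 : ∀ j : Fin p, w j.castSucc = -(w (Fin.last p)) * c j := fun j => congrFun h3 j
  simp only [h7, mul_assoc, ← Finset.mul_sum] at h2
  apply mul_left_cancel₀ hwl
  linarith

theorem mem_criticalSet_of_isMultiplier {x : Fin n → ℝ} (hF : ∀ j, eval x (F j) = 0)
    {c : Fin p → ℝ} (hc : IsMultiplier F G x c) :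
    (fun i => (x i : ℂ)) ∈ criticalSet F G := by
  refine ⟨fun j => by simp [aeval_ofReal, hF], ?_⟩
  -- The gradient of `G` is a combination of the rows of `F`, so the augmented Jacobian factors
  -- through a matrix with `p` columns.
  let B : Matrix (Fin (p + 1)) (Fin p) ℂ :=
    Matrix.of (Fin.snoc (α := fun _ => Fin p → ℂ) (fun j => Pi.single j 1) fun j => (c j : ℂ))
  have hBl : ∀ j, B (Fin.last p) j = c j := fun j => by simp [B]
  have hBc : ∀ j j', B (Fin.castSucc j) j' = (Pi.single j 1 : Fin p → ℂ) j' := fun j j' => by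
    simp [B]
  have hB : jacobianAt (withObjective F G) (fun i => (x i : ℂ)) =
      B * jacobianAt F (fun i => (x i : ℂ)) := by
    ext r l
    induction r using Fin.lastCases with
    | last =>
      have := hc l
      simp [jacobianAt, jacobian, withObjective, hBl, Matrix.mul_apply, aeval_ofReal, this]
    | cast j =>
      simp [jacobianAt, jacobian, withObjective, hBc, Matrix.mul_apply, aeval_ofReal, Pi.single_apply]
  rw [hB]
  exact (Matrix.rank_mul_le_left _ _).trans (Matrix.rank_le_width B)

theorem exists_isMultiplier_of_mem_criticalSet {x : Fin n → ℝ} (hΔ : eval x (Δ F J) ≠ 0)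
    (hx : (fun i => (x i : ℂ)) ∈ criticalSet F G) : ∃ c, IsMultiplier F G x c :=
  exists_isMultiplier_of_M_eq_zero F G J hΔ fun i => by
    have := aeval_M_eq_zero_of_mem_criticalSet F G J hx i
    rw [aeval_ofReal] at this
    exact_mod_cast this

/-- A critical point in `D_{n-p}` lies, for some `m`, outside `D_m` and on a component of dimension
at least `n - p - m`. -/
theorem exists_component_of_mem_D (hdim : ∀ C, IsComponentOf C (criticalSet F G) →
      zariskiDim C < ((n - p : ℕ) : WithBot ℕ∞)) {z : Fin n → ℂ} (hz : z ∈ D F G (n - p)) :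
    ∃ m C, m < n - p ∧ 1 ≤ m ∧ z ∉ D F G m ∧ IsComponentOf C (criticalSet F G) ∧ z ∈ C ∧
      ((n - p - m : ℕ) : WithBot ℕ∞) ≤ zariskiDim C := by
  classical
  let P : ℕ → Prop := fun k => z ∈ D F G k
  have hP : ∃ k, P k := ⟨n - p, hz⟩
  have hspec : z ∈ D F G (Nat.find hP) := Nat.find_spec hP
  have hle : Nat.find hP ≤ n - p := Nat.find_min' hP hz
  obtain ⟨C, ⟨hC, hCdim⟩, hzC⟩ := hspec
  -- Take the least `k` with `z` in `D_k`. Components have dimension below `n - p`, so `D_0` and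
  -- `D_1` are empty and `m = k - 1` is at least `1`.
  have hk : 2 ≤ Nat.find hP := by
    by_contra hlt
    have h3 : ((n - p - Nat.find hP + 1 : ℕ) : WithBot ℕ∞) ≤ zariskiDim C := by
      exact_mod_cast ENat.WithBot.add_one_le_iff.mpr hCdim
    have h4 := h3.trans_lt (hdim C hC)
    have h5 : n - p - Nat.find hP + 1 < n - p := by exact_mod_cast h4
    omega
  refine ⟨Nat.find hP - 1, C, by omega, by omega,
    fun h => Nat.find_min hP (by omega) h, hC, hzC, ?_⟩
  have : n - p - (Nat.find hP - 1) = n - p - Nat.find hP + 1 := by omega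
  rw [this]
  exact_mod_cast ENat.WithBot.add_one_le_iff.mpr hCdim

end PolyOpt

namespace PolyOpt

open MvPolynomial Filter

variable {n p : ℕ}

/-! ### Polynomials along integral curves of polynomial vector fields -/

theorem hasDerivAt_eval_of_pi {𝕜 : Type*} [RCLike 𝕜] {z : ℝ → Fin n → 𝕜} {z' : Fin n → 𝕜} {t : ℝ}
    (hz : ∀ l, HasDerivAt (fun s => z s l) (z' l) t) (g : MvPolynomial (Fin n) 𝕜) :
    HasDerivAt (fun s => eval (z s) g) (∑ l, z' l * eval (z t) (pderiv l g)) t := by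
  induction g using MvPolynomial.induction_on with
  | C a => simpa using hasDerivAt_const t a
  | add q r hq hr =>
    simp only [map_add, mul_add, Finset.sum_add_distrib]
    exact hq.add hr
  | mul_X q i hq =>
    have heq : ∑ l, z' l * eval (z t) (pderiv l (q * X i)) =
        (∑ l, z' l * eval (z t) (pderiv l q)) * z t i + eval (z t) q * z' i := by
      simp only [Derivation.leibniz, smul_eq_mul, pderiv_X, map_add, map_mul, mul_add,
        Finset.sum_add_distrib, eval_X, Finset.sum_mul]
      rw [add_comm]
      congr 1
      · exact Finset.sum_congr rfl fun l _ => by ring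
      · rw [Finset.sum_eq_single i]
        · simp [mul_comm]
        · intro b _ hb
          simp [Ne.symm hb]
        · simp
    rw [heq]
    simp only [map_mul, eval_X]
    exact hq.mul (hz i)

theorem contDiff_eval (g : MvPolynomial (Fin n) ℝ) {m : WithTop ℕ∞} :
    ContDiff ℝ m fun y : Fin n → ℝ => eval y g := by
  induction g using MvPolynomial.induction_on with
  | C a => simpa using contDiff_const
  | add q r hq hr => simpa using hq.add hr
  | mul_X q i hq => simpa using hq.mul (contDiff_apply ℝ ℝ i)

/-- The derivative of a polynomial function. -/
noncomputable def gradient (g : MvPolynomial (Fin n) ℝ) (x : Fin n → ℝ) : (Fin n → ℝ) →L[ℝ] ℝ :=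
  ∑ l, eval x (pderiv l g) • ContinuousLinearMap.proj l

theorem gradient_apply (g : MvPolynomial (Fin n) ℝ) (x v : Fin n → ℝ) :
    gradient g x v = ∑ l, v l * eval x (pderiv l g) := by
  simp [gradient, mul_comm]

theorem hasFDerivAt_eval (g : MvPolynomial (Fin n) ℝ) (x : Fin n → ℝ) :
    HasFDerivAt (fun y => eval y g) (gradient g x) x := by
  have h : DifferentiableAt ℝ (fun y : Fin n → ℝ => eval y g) x :=
    (contDiff_eval g (m := 1)).differentiable one_ne_zero x
  convert h.hasFDerivAt using 1
  ext1 v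
  have h1 : HasDerivAt (fun t : ℝ => x + t • v) v 0 := by
    simpa using ((hasDerivAt_id (0 : ℝ)).smul_const v).const_add x
  have h2 := hasDerivAt_eval_of_pi (hasDerivAt_pi.mp h1) g
  have h3 : HasFDerivAt (fun y : Fin n → ℝ => eval y g)
      (fderiv ℝ (fun y : Fin n → ℝ => eval y g) x) (x + (0 : ℝ) • v) := by
    simpa using h.hasFDerivAt
  have h4 := h2.unique (h3.comp_hasDerivAt (f := fun t : ℝ => x + t • v)
    (l := fun y : Fin n → ℝ => eval y g) 0 h1)
  rw [← h4, gradient_apply]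
  simp

theorem hasStrictFDerivAt_eval (g : MvPolynomial (Fin n) ℝ) (x : Fin n → ℝ) :
    HasStrictFDerivAt (fun y => eval y g) (gradient g x) x :=
  (contDiff_eval g (m := 1)).contDiffAt.hasStrictFDerivAt' (hasFDerivAt_eval g x) one_ne_zero

theorem hasDerivAt_eval_comp {γ : ℝ → Fin n → ℝ} {γ' : Fin n → ℝ} {t : ℝ}
    (h : HasDerivAt γ γ' t) (g : MvPolynomial (Fin n) ℝ) :
    HasDerivAt (fun s => eval (γ s) g) (∑ l, γ' l * eval (γ t) (pderiv l g)) t := by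
  rw [← gradient_apply]
  exact (hasFDerivAt_eval g (γ t)).comp_hasDerivAt t h

theorem exists_integralCurve (v : Fin n → MvPolynomial (Fin n) ℝ) (x : Fin n → ℝ) :
    ∃ γ : ℝ → Fin n → ℝ, γ 0 = x ∧ ∃ ε > 0, ∀ t ∈ Set.Ioo (-ε) ε,
      HasDerivAt γ (fun l => eval (γ t) (v l)) t := by
  have hv : ContDiffAt ℝ 1 (fun y : Fin n → ℝ => fun l => eval y (v l)) x :=
    (contDiff_pi.mpr fun l => contDiff_eval (v l)).contDiffAt
  obtain ⟨γ, h0, ε, hε, h⟩ :=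
    hv.exists_forall_mem_closedBall_exists_eq_forall_mem_Ioo_hasDerivAt₀ 0
  exact ⟨γ, h0, ε, hε, by simpa using h⟩

/-- An integral curve of a polynomial vector field which preserves an ideal `P` and which starts at a
zero of `P` consists of zeros of `P`. -/
theorem eval_eq_zero_of_integralCurve (P : Ideal (MvPolynomial (Fin n) ℂ))
    (v : Fin n → MvPolynomial (Fin n) ℝ)
    (hv : ∀ g ∈ P, ∑ l, map (algebraMap ℝ ℂ) (v l) * pderiv l g ∈ P)
    {γ : ℝ → Fin n → ℝ} {ε : ℝ} (hε : 0 < ε)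
    (hγ : ∀ t ∈ Set.Ioo (-ε) ε, HasDerivAt γ (fun l => eval (γ t) (v l)) t)
    (h0 : ∀ g ∈ P, eval (fun l => (γ 0 l : ℂ)) g = 0) :
    ∃ δ > 0, ∀ t ∈ Set.Icc 0 δ, ∀ g ∈ P, eval (fun l => (γ t l : ℂ)) g = 0 := by
  -- The field sends each of finitely many generators to a combination of generators. Their values
  -- along the curve thus solve a homogeneous linear system with zero initial value.
  obtain ⟨s, hs⟩ := (isNoetherianRing_iff_ideal_fg _).mp inferInstance P
  have hmem : ∀ a : s, (a : MvPolynomial (Fin n) ℂ) ∈ P := fun a => by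
    rw [← hs]; exact Ideal.subset_span a.2
  have hH : ∀ a : s, ∃ H : s → MvPolynomial (Fin n) ℂ,
      ∑ l, map (algebraMap ℝ ℂ) (v l) * pderiv l (a : MvPolynomial (Fin n) ℂ) =
        ∑ b, H b * (b : MvPolynomial (Fin n) ℂ) := fun a => by
    have h := hv a (hmem a)
    rw [← hs] at h
    obtain ⟨H, hH⟩ := (Submodule.mem_span_range_iff_exists_fun
      (R := MvPolynomial (Fin n) ℂ) (v := fun b : s => (b : MvPolynomial (Fin n) ℂ))).mp
      (by simpa [Ideal.span] using h)
    exact ⟨H, by simpa using hH.symm⟩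
  choose H hH using hH
  let z : ℝ → Fin n → ℂ := fun t l => (γ t l : ℂ)
  let u : ℝ → s → ℂ := fun t a => eval (z t) (a : MvPolynomial (Fin n) ℂ)
  have hz : ∀ t ∈ Set.Ioo (-ε) ε, ∀ l, HasDerivAt (fun t => z t l) (eval (γ t) (v l) : ℂ) t :=
    fun t ht l => (hasDerivAt_pi.mp (hγ t ht) l).ofReal_comp
  have hu : ∀ t ∈ Set.Ioo (-ε) ε,
      HasDerivAt u (fun a => ∑ b, eval (z t) (H a b) * u t b) t := fun t ht => by
    rw [hasDerivAt_pi]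
    intro a
    have h := hasDerivAt_eval_of_pi (hz t ht) (a : MvPolynomial (Fin n) ℂ)
    have h2 := congrArg (eval (z t)) (hH a)
    simp only [map_sum, map_mul] at h2
    have h3 : ∑ b, eval (z t) (H a b) * u t b =
        ∑ l, (eval (γ t) (v l) : ℂ) * eval (z t) (pderiv l (a : MvPolynomial (Fin n) ℂ)) := by
      rw [← h2]
      refine Finset.sum_congr rfl fun l _ => ?_
      rw [eval_map_ofReal]
    rw [h3]
    exact h
  have hzc : ∀ t ∈ Set.Ioo (-ε) ε, ContinuousAt z t := fun t ht =>
    continuousAt_pi.mpr fun l => (hz t ht l).continuousAt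
  -- Near `0` the coefficients stay below their value at `0` plus one, which is the constant in
  -- Grönwall's inequality.
  have hcont : ContinuousAt (fun t => ∑ a, ∑ b, ‖eval (z t) (H a b)‖) 0 :=
    tendsto_finsetSum _ fun a _ => tendsto_finsetSum _ fun b _ =>
      ((MvPolynomial.continuous_eval (H a b)).continuousAt.comp
        (hzc 0 ⟨by linarith, hε⟩)).norm
  have hbd := hcont.eventually (eventually_le_nhds (lt_add_one _))
  obtain ⟨δ', hδ', hball⟩ := Metric.eventually_nhds_iff.mp hbd
  refine ⟨min (δ' / 2) (ε / 2), by positivity, ?_⟩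
  set δ := min (δ' / 2) (ε / 2) with hδ
  have hδ1 : δ ≤ δ' / 2 := min_le_left _ _
  have hδ2 : δ ≤ ε / 2 := min_le_right _ _
  have hin : ∀ t ∈ Set.Icc 0 δ, t ∈ Set.Ioo (-ε) ε := fun t ht =>
    ⟨by linarith [ht.1], by linarith [ht.2]⟩
  have hu0 : ∀ t ∈ Set.Icc 0 δ, u t = 0 := by
    refine eq_zero_of_abs_deriv_le_mul_abs_self_of_eq_zero_right
      (K := (∑ a, ∑ b, ‖eval (z 0) (H a b)‖) + 1)
      (fun t ht => (hu t (hin t ht)).continuousAt.continuousWithinAt)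
      (fun t ht => (hu t (hin t ⟨ht.1, ht.2.le⟩)).hasDerivWithinAt)
      (funext fun a => h0 a (hmem a)) ?_
    intro t ht
    have hle := hball (y := t) (by
      rw [Real.dist_eq, sub_zero, abs_of_nonneg ht.1]; linarith [ht.2])
    refine (pi_norm_le_iff_of_nonneg (by positivity)).mpr fun a => ?_
    calc ‖∑ b, eval (z t) (H a b) * u t b‖ ≤ ∑ b, ‖eval (z t) (H a b)‖ * ‖u t‖ := by
          refine norm_sum_le_of_le _ fun b _ => ?_
          rw [norm_mul]
          gcongr
          exact norm_le_pi_norm (u t) b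
      _ = (∑ b, ‖eval (z t) (H a b)‖) * ‖u t‖ := by rw [Finset.sum_mul]
      _ ≤ (∑ a, ∑ b, ‖eval (z t) (H a b)‖) * ‖u t‖ := by
          refine mul_le_mul_of_nonneg_right ?_ (norm_nonneg _)
          exact Finset.single_le_sum (f := fun a => ∑ b, ‖eval (z t) (H a b)‖)
            (fun _ _ => by positivity) (Finset.mem_univ a)
      _ ≤ _ := by gcongr
  intro t ht g hg
  have hle : P ≤ RingHom.ker (eval (z t)) := by
    rw [← hs, Ideal.span_le]
    intro a ha
    exact congrFun (hu0 t ht) ⟨a, ha⟩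
  exact hle hg

end PolyOpt

namespace PolyOpt

open MvPolynomial Filter

variable {n p : ℕ}
variable (F : Fin p → MvPolynomial (Fin n) ℝ) (G : MvPolynomial (Fin n) ℝ) (J : Fin p ↪o Fin n)

/-! ### Local minima are critical -/

theorem nhdsWithin_chart {x : Fin n → ℝ} (hΔ : eval x (Δ F J) ≠ 0) :
    𝓝[realTrace (localized (zeroSet F) (Δ F J))] x = 𝓝[{y | ∀ j, eval y (F j) = 0}] x := by
  have h : realTrace (localized (zeroSet F) (Δ F J)) =
      {y | ∀ j, eval y (F j) = 0} ∩ {y | eval y (Δ F J) ≠ 0} := by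
    ext y
    exact mem_realTrace_chart F J
  rw [h]
  exact (nhdsWithin_inter_of_mem' (mem_nhdsWithin_of_mem_nhds
    ((MvPolynomial.continuous_eval (Δ F J)).continuousAt.eventually_ne hΔ)))

theorem eq_zero_of_sum_mul_jacobian_eq_zero {x : Fin n → ℝ} (hΔ : eval x (Δ F J) ≠ 0) {c : Fin p → ℝ}
    (hc : ∀ l, ∑ j, c j * eval x (pderiv l (F j)) = 0) : c = 0 := by
  have hdet : ((jacobianAt F x).submatrix id J).det ≠ 0 := by
    have : eval x (Δ F J) = ((jacobianAt F x).submatrix id J).det := by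
      rw [Δ, RingHom.map_det]; rfl
    rwa [this] at hΔ
  exact Matrix.eq_zero_of_vecMul_eq_zero hdet (funext fun j => hc (J j))

theorem exists_isMultiplier_of_isLocalMinOn {x : Fin n → ℝ}
    (hx : x ∈ realTrace (localized (zeroSet F) (Δ F J)))
    (hmin : IsLocalMinOn (fun y => eval y G) (realTrace (localized (zeroSet F) (Δ F J))) x) :
    ∃ c, IsMultiplier F G x c := by
  obtain ⟨hF, hΔ⟩ := (mem_realTrace_chart F J).mp hx
  have hextr : IsLocalExtrOn (fun y => eval y G) {y | ∀ j, eval y (F j) = eval x (F j)} x := by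
    left
    simp only [hF]
    rwa [IsLocalMinOn, IsMinFilter, nhdsWithin_chart F J hΔ] at hmin
  obtain ⟨a, b, hab, h⟩ := hextr.exists_multipliers_of_hasStrictFDerivAt
    (fun j => hasStrictFDerivAt_eval (F j) x) (hasStrictFDerivAt_eval G x)
  have h' : ∀ l, ∑ j, a j * eval x (pderiv l (F j)) + b * eval x (pderiv l G) = 0 := fun l => by
    have := congrArg (fun φ : (Fin n → ℝ) →L[ℝ] ℝ => φ (Pi.single l 1)) h
    simpa [gradient_apply, Pi.single_apply] using this
  -- If the coefficient of `G` were zero, the relation would be among the rows of `F`, which are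
  -- independent where `Δ F J` is nonzero.
  have hb : b ≠ 0 := by
    rintro rfl
    apply hab
    rw [eq_zero_of_sum_mul_jacobian_eq_zero F J hΔ (c := a) (by simpa using h')]
    rfl
  refine ⟨fun j => -(a j / b), fun l => ?_⟩
  have h1 : ∑ j, -(a j / b) * eval x (pderiv l (F j)) =
      -(∑ j, a j * eval x (pderiv l (F j))) / b := by
    rw [← Finset.sum_neg_distrib, Finset.sum_div]
    exact Finset.sum_congr rfl fun j _ => by ring
  rw [h1, eq_div_iff hb]
  linarith [h' l]

theorem M_eq_zero_of_isMultiplier {x : Fin n → ℝ} (hF : ∀ j, eval x (F j) = 0) {c : Fin p → ℝ}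
    (hc : IsMultiplier F G x c) (i : Fin (n - p)) : eval x (M F G J i) = 0 := by
  have := aeval_M_eq_zero_of_mem_criticalSet F G J (mem_criticalSet_of_isMultiplier F G hF hc) i
  rw [aeval_ofReal] at this
  exact_mod_cast this

/-! ### Isolated local minima lie on no component of positive dimension -/

/-- Covers the case `n = p`: there are no minors and Condition B is vacuous, so regularity comes
from `F` alone. -/
theorem isRegularAt_sumElim_of_isEmpty {ι κ : Type*} [Fintype ι] [Fintype κ] [IsEmpty κ]
    {f : ι → MvPolynomial (Fin n) ℝ} (g : κ → MvPolynomial (Fin n) ℝ) {x : Fin n → ℝ}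
    (hf : IsRegularAt f x) : IsRegularAt (Sum.elim f g) x := by
  have h : jacobianAt (Sum.elim f g) x =
      (jacobianAt f x).submatrix (Equiv.sumEmpty ι κ) (Equiv.refl (Fin n)) := by
    ext i l
    rcases i with i | i
    · rfl
    · exact isEmptyElim i
  rw [IsRegularAt, h, Matrix.rank_submatrix, hf]
  simp

/-- If a regular family vanishes on an irreducible set `C` of the expected dimension, then through
every real point of `C` there is a real curve in the zero set of the ideal of `C`, which is an
integral curve of a polynomial vector field annihilating the family. -/
theorem exists_curve_of_isRegularAt {ι : Type*} [Fintype ι] (f : ι → MvPolynomial (Fin n) ℝ)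
    {C : Set (Fin n → ℂ)} (hC : ZariskiIrreducible C) (hCf : C ⊆ zeroSet f)
    (hcard : Fintype.card ι < n)
    (hdim : ((n - Fintype.card ι : ℕ) : WithBot ℕ∞) ≤ zariskiDim C) {x : Fin n → ℝ}
    (hx : x ∈ realTrace C) (hreg : IsRegularAt f x) :
    ∃ (v : Fin n → MvPolynomial (Fin n) ℝ) (γ : ℝ → Fin n → ℝ),
      γ 0 = x ∧ (∀ i, ∑ l, v l * pderiv l (f i) = 0) ∧ (∃ l, eval x (v l) ≠ 0) ∧
      ∃ δ > 0, ∀ t ∈ Set.Icc 0 δ, HasDerivAt γ (fun l => eval (γ t) (v l)) t ∧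
        ∀ g ∈ vanishingIdeal ℂ C, eval (fun l => (γ t l : ℂ)) g = 0 := by
  classical
  obtain ⟨S, hS⟩ := exists_submatrix_det_ne_zero (jacobianAt f x) hreg
  -- A free direction exists because there are fewer equations than variables. It makes the field
  -- nonzero at `x`, its component there being the chosen minor.
  obtain ⟨i, hi⟩ : ∃ i, i ∉ Set.range S := by
    by_contra! hsurj
    have := Fintype.card_le_of_surjective S hsurj
    rw [Fintype.card_fin] at this
    omega
  have hdet : eval x ((jacobian f).submatrix id S).det ≠ 0 := by
    rw [RingHom.map_det]
    exact hS
  let v := tangentField (jacobian f) S i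
  have hv : ∀ r, ∑ l, v l * pderiv l (f r) = 0 := fun r =>
    sum_tangentField_mul_row (jacobian f) S i r
  have hprime := isPrime_vanishingIdeal hC
  have hmem : ∀ q : MvPolynomial (Fin n) ℂ, q ∈ vanishingIdeal ℂ C → ∀ z ∈ C, eval z q = 0 :=
    fun q hq z hz => hq z hz
  have htan : ∀ g ∈ vanishingIdeal ℂ C,
      ∑ l, map (algebraMap ℝ ℂ) (v l) * pderiv l g ∈ vanishingIdeal ℂ C := fun g hg => by
    refine sum_mul_pderiv_mem_of_isPrime (vanishingIdeal ℂ C)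
      (fun r => map (algebraMap ℝ ℂ) (f r)) (fun r z hz => ?_) S (fun hmem' => ?_) hdim _
      (fun r => ?_) hg
    · have := hCf hz r
      rwa [aeval_def, ← eval_map] at this
    -- The minor is outside the ideal of `C` since it is nonzero at the point `x` of `C`.
    · have h1 := hmem _ hmem' _ hx
      have h2 : (Matrix.of fun r j => pderiv (S j) (map (algebraMap ℝ ℂ) (f r))).det =
          map (algebraMap ℝ ℂ) ((jacobian f).submatrix id S).det := by
        rw [RingHom.map_det]
        congr 1
        ext1 r j
        exact pderiv_map
      rw [h2, eval_map_ofReal] at h1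
      exact hdet (by exact_mod_cast h1)
    · have h1 := congrArg (MvPolynomial.map (algebraMap ℝ ℂ)) (hv r)
      simp only [map_sum, map_mul, map_zero, ← pderiv_map] at h1
      rw [h1]
      exact Ideal.zero_mem _
  obtain ⟨γ, h0, ε, hε, hγ⟩ := exists_integralCurve v x
  obtain ⟨δ, hδ, hzero⟩ := eval_eq_zero_of_integralCurve (vanishingIdeal ℂ C) v htan hε hγ
    (fun g hg => by rw [h0]; exact hmem g hg _ hx)
  refine ⟨v, γ, h0, hv, ⟨i, ?_⟩, min δ (ε / 2), by positivity, fun t ht => ⟨hγ t ?_, hzero t ?_⟩⟩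
  · rw [show v i = _ from tangentField_apply_self _ _ _ hi]
    exact hdet
  · exact ⟨by linarith [ht.1], by linarith [ht.2, min_le_right δ (ε / 2)]⟩
  · exact ⟨ht.1, ht.2.trans (min_le_left _ _)⟩

/-- A component of positive dimension through `x` would carry a curve of critical points on which
`G` is constant, hence local minima arbitrarily close to `x`. -/
theorem not_mem_D_of_isIsolatedLocalMinOn (hB : ConditionB F G) (hpn : 1 ≤ n - p)
    {x : Fin n → ℝ}
    (hx : IsIsolatedLocalMinOn (fun y => eval y G)
      (realTrace (localized (zeroSet F) (Δ F J))) x) :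
    (fun i => (x i : ℂ)) ∉ D F G (n - p) := by
  intro hD
  obtain ⟨hxS, hmin, hiso⟩ := hx
  obtain ⟨hF, hΔ⟩ := (mem_realTrace_chart F J).mp hxS
  obtain ⟨c, hc⟩ := exists_isMultiplier_of_isLocalMinOn F G J hxS hmin
  obtain ⟨m, C, hm, hm1, hDm, hC, hxC, hdim⟩ := exists_component_of_mem_D F G
    (fun C hC => ((hB J (n - p) le_rfl hpn).2.2 C hC).1) hD
  have hCW : C ⊆ criticalSet F G := hC.prop.1
  let f := withMinors F G J m hm.le
  have hCf : C ⊆ zeroSet f := by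
    rintro z hz (j | i)
    · exact (hCW hz).1 j
    · exact aeval_M_eq_zero_of_mem_criticalSet F G J (hCW hz) _
  have hreg : IsRegularAt f x := (hB J m hm.le hm1).1 x
    ⟨⟨hCf hxC, by rw [aeval_ofReal]; exact_mod_cast hΔ⟩, hDm⟩
  have hcard : Fintype.card (Fin p ⊕ Fin m) = p + m := by simp
  obtain ⟨v, γ, h0, hv, ⟨l, hl⟩, δ, hδ, hγ⟩ := exists_curve_of_isRegularAt f hC.prop.2 hCf
    (by rw [hcard]; omega) (by rw [hcard, ← Nat.sub_sub]; exact hdim) hxC hreg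
  have hγF : ∀ t ∈ Set.Icc 0 δ, ∀ j, eval (γ t) (F j) = 0 := fun t ht j => by
    have := (hγ t ht).2 (map (algebraMap ℝ ℂ) (F j)) fun z hz => by
      rw [aeval_map_algebraMap]
      exact (hCW hz).1 j
    rw [eval_map_ofReal] at this
    exact_mod_cast this
  have hγM : ∀ t ∈ Set.Icc 0 δ, ∀ i, eval (γ t) (M F G J i) = 0 := fun t ht i => by
    have := (hγ t ht).2 (map (algebraMap ℝ ℂ) (M F G J i)) fun z hz => by
      rw [aeval_map_algebraMap]
      exact aeval_M_eq_zero_of_mem_criticalSet F G J (hCW hz) _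
    rw [eval_map_ofReal] at this
    exact_mod_cast this
  have hd0 := (hγ 0 ⟨le_rfl, hδ.le⟩).1
  have hγ0 : Tendsto γ (𝓝 0) (𝓝 x) := by
    have := hd0.continuousAt.tendsto
    rwa [h0] at this
  obtain ⟨η, hη, hball⟩ := Metric.eventually_nhds_iff.mp (hγ0.eventually
    ((MvPolynomial.continuous_eval (Δ F J)).continuousAt.eventually_ne hΔ))
  let δ' := min δ (η / 2)
  have hδ' : 0 < δ' := by positivity
  have hsub : ∀ t ∈ Set.Icc 0 δ', t ∈ Set.Icc 0 δ := fun t ht =>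
    ⟨ht.1, ht.2.trans (min_le_left _ _)⟩
  have hγΔ : ∀ t ∈ Set.Icc 0 δ', eval (γ t) (Δ F J) ≠ 0 := fun t ht => hball (by
    rw [Real.dist_eq, sub_zero, abs_of_nonneg ht.1]
    linarith [ht.2, min_le_right δ (η / 2)])
  -- At a critical point the gradient of `G` is a combination of those of the `F j`, all annihilated
  -- by the velocity of the curve.
  have hderiv : ∀ t ∈ Set.Icc 0 δ', HasDerivAt (fun s => eval (γ s) G) 0 t := fun t ht => by
    obtain ⟨b, hb⟩ := exists_isMultiplier_of_M_eq_zero F G J (hγΔ t ht) (hγM t (hsub t ht))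
    convert hasDerivAt_eval_comp (hγ t (hsub t ht)).1 G using 1
    simp only [hb _, Finset.mul_sum]
    rw [Finset.sum_comm]
    refine (Finset.sum_eq_zero fun j _ => ?_).symm
    have h1 := congrArg (eval (γ t)) (hv (Sum.inl j))
    simp only [map_sum, map_mul, map_zero] at h1
    have h2 : ∑ l, eval (γ t) (v l) * (b j * eval (γ t) (pderiv l (F j))) =
        b j * ∑ l, eval (γ t) (v l) * eval (γ t) (pderiv l (F j)) := by
      rw [Finset.mul_sum]
      exact Finset.sum_congr rfl fun l _ => by ring
    rw [h2]
    exact mul_eq_zero_of_right _ h1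
  have hconst : ∀ t ∈ Set.Icc 0 δ', eval (γ t) G = eval x G := fun t ht => by
    have := constant_of_has_deriv_right_zero
      (fun t ht => (hderiv t ht).continuousAt.continuousWithinAt)
      (fun t ht => (hderiv t ⟨ht.1, ht.2.le⟩).hasDerivWithinAt) t ht
    rwa [h0] at this
  have hev : ∀ᶠ t in 𝓝[>] (0 : ℝ), t ∈ Set.Icc 0 δ' :=
    mem_of_superset (Ioc_mem_nhdsGT hδ') Set.Ioc_subset_Icc_self
  have htend : Tendsto γ (𝓝[>] 0) (𝓝[realTrace (localized (zeroSet F) (Δ F J))] x) :=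
    tendsto_nhdsWithin_iff.mpr ⟨hγ0.mono_left nhdsWithin_le_nhds, hev.mono fun t ht =>
      (mem_realTrace_chart F J).mpr ⟨hγF t (hsub t ht), hγΔ t ht⟩⟩
  -- For small `t`, the bound `G ≥ G(x)` holds in a whole neighborhood of `γ t` in the chart. Since
  -- `G (γ t) = G(x)`, the point `γ t` is itself a local minimum.
  have h1 := htend.eventually (eventually_eventually_nhdsWithin.mpr hmin)
  have h2 := htend.eventually hiso
  have h3 : ∀ᶠ t in 𝓝[>] (0 : ℝ), γ t = x := by
    filter_upwards [h1, h2, hev] with t h1 h2 h3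
    refine h2 ?_
    filter_upwards [h1] with w hw
    rw [hconst t h3]
    exact hw
  -- The `l`-th velocity component at `0` is nonzero, so the curve leaves `x` at once.
  have h4 : ∀ᶠ t in 𝓝[>] (0 : ℝ), γ t l ≠ x l := by
    have h5 : HasDerivAt (fun t => γ t l) (eval x (v l)) 0 := by
      have := hasDerivAt_pi.mp hd0 l
      rwa [h0] at this
    exact (h5.eventually_ne hl).filter_mono (nhdsGT_le_nhdsNE 0)
  obtain ⟨t, h5, h6⟩ := (h3.and h4).exists
  exact h6 (congrFun h5 l)

end PolyOpt

namespace PolyOpt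

open MvPolynomial Filter

variable {n p : ℕ}

/-! ### Second order conditions -/

/-- The commutator of two derivations is a derivation, and this one kills the variables. -/
theorem pderiv_pderiv_comm {R : Type*} [CommRing R] (i j : Fin n) (g : MvPolynomial (Fin n) R) :
    pderiv i (pderiv j g) = pderiv j (pderiv i g) := by
  have h : ⁅(pderiv i : Derivation R (MvPolynomial (Fin n) R) _), pderiv j⁆ = 0 :=
    MvPolynomial.derivation_ext fun k => by
      rw [Derivation.commutator_apply, pderiv_X, pderiv_X]
      by_cases hi : i = k <;> by_cases hj : j = k <;> simp [hi, hj, Ne.symm]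
  have := congrArg (fun D : Derivation R (MvPolynomial (Fin n) R) (MvPolynomial (Fin n) R) => D g) h
  simpa [Derivation.commutator_apply, sub_eq_zero] using this

/-- The second derivative of a polynomial function, as a bilinear form. -/
noncomputable def secondDeriv (g : MvPolynomial (Fin n) ℝ) (x u w : Fin n → ℝ) : ℝ :=
  ∑ m, u m * ∑ l, w l * eval x (pderiv m (pderiv l g))

theorem secondDeriv_smul (g : MvPolynomial (Fin n) ℝ) (x u w : Fin n → ℝ) (a b : ℝ) :
    secondDeriv g x (a • u) (b • w) = a * b * secondDeriv g x u w := by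
  simp only [secondDeriv, Pi.smul_apply, smul_eq_mul, Finset.mul_sum]
  exact Finset.sum_congr rfl fun _ _ => Finset.sum_congr rfl fun _ _ => by ring

theorem hasDerivAt_line (x d : Fin n → ℝ) (t : ℝ) : HasDerivAt (fun s : ℝ => x + s • d) d t := by
  simpa using ((hasDerivAt_id t).smul_const d).const_add x

theorem hasDerivAt_eval_line (g : MvPolynomial (Fin n) ℝ) (x d : Fin n → ℝ) (t : ℝ) :
    HasDerivAt (fun s : ℝ => eval (x + s • d) g) (gradient g (x + t • d) d) t := by
  rw [gradient_apply]
  exact hasDerivAt_eval_comp (hasDerivAt_line x d t) g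

theorem hasDerivAt_gradient_line (g : MvPolynomial (Fin n) ℝ) (x d : Fin n → ℝ) (t : ℝ) :
    HasDerivAt (fun s : ℝ => gradient g (x + s • d) d) (secondDeriv g (x + t • d) d d) t := by
  have h : secondDeriv g (x + t • d) d d =
      ∑ l, d l * gradient (pderiv l g) (x + t • d) d := by
    simp only [secondDeriv, gradient_apply, Finset.mul_sum]
    rw [Finset.sum_comm]
    exact Finset.sum_congr rfl fun _ _ => Finset.sum_congr rfl fun _ _ => by ring
  rw [h]
  simp only [gradient_apply g]
  exact HasDerivAt.fun_sum fun l _ => (hasDerivAt_eval_line (pderiv l g) x d t).const_mul (d l)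

theorem exists_gradient_eq_zero {g : MvPolynomial (Fin n) ℝ} {x y : Fin n → ℝ}
    (h : eval y g = eval x g) :
    ∃ t ∈ Set.Ioo (0 : ℝ) 1, gradient g (x + t • (y - x)) (y - x) = 0 := by
  obtain ⟨t, ht, h1⟩ := exists_hasDerivAt_eq_slope (fun s : ℝ => eval (x + s • (y - x)) g)
    (fun t => gradient g (x + t • (y - x)) (y - x)) one_pos
    (fun t _ => (hasDerivAt_eval_line g x (y - x) t).continuousAt.continuousWithinAt)
    (fun t _ => hasDerivAt_eval_line g x (y - x) t)
  exact ⟨t, ht, by simpa [h] using h1⟩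

theorem exists_secondDeriv_neg {g : MvPolynomial (Fin n) ℝ} {x y : Fin n → ℝ}
    (hg : gradient g x = 0) (h : eval y g < eval x g) :
    ∃ t ∈ Set.Ioo (0 : ℝ) 1, secondDeriv g (x + t • (y - x)) (y - x) (y - x) < 0 := by
  obtain ⟨t, ht, h1⟩ := exists_hasDerivAt_eq_slope (fun s : ℝ => eval (x + s • (y - x)) g)
    (fun t => gradient g (x + t • (y - x)) (y - x)) one_pos
    (fun t _ => (hasDerivAt_eval_line g x (y - x) t).continuousAt.continuousWithinAt)
    (fun t _ => hasDerivAt_eval_line g x (y - x) t)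
  have h2 : gradient g (x + t • (y - x)) (y - x) < 0 := by
    rw [h1]
    simpa using h
  obtain ⟨s, hs, h3⟩ := exists_hasDerivAt_eq_slope
    (fun t => gradient g (x + t • (y - x)) (y - x))
    (fun t => secondDeriv g (x + t • (y - x)) (y - x) (y - x)) ht.1
    (fun t _ => (hasDerivAt_gradient_line g x (y - x) t).continuousAt.continuousWithinAt)
    (fun t _ => hasDerivAt_gradient_line g x (y - x) t)
  refine ⟨s, ⟨hs.1, hs.2.trans ht.2⟩, ?_⟩
  rw [h3]
  simp only [zero_smul, add_zero, hg, zero_apply, sub_zero]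
  exact div_neg_of_neg_of_pos h2 ht.1

theorem tendsto_gradient {α : Type*} {𝒰 : Filter α} {a b : α → Fin n → ℝ} {x e : Fin n → ℝ}
    (ha : Tendsto a 𝒰 (𝓝 x)) (hb : Tendsto b 𝒰 (𝓝 e)) (g : MvPolynomial (Fin n) ℝ) :
    Tendsto (fun y => gradient g (a y) (b y)) 𝒰 (𝓝 (gradient g x e)) := by
  simp only [gradient_apply]
  exact tendsto_finsetSum _ fun l _ => (((continuous_apply l).tendsto e).comp hb).mul
    (((MvPolynomial.continuous_eval (pderiv l g)).tendsto x).comp ha)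

theorem tendsto_secondDeriv {α : Type*} {𝒰 : Filter α} {a b : α → Fin n → ℝ} {x e : Fin n → ℝ}
    (ha : Tendsto a 𝒰 (𝓝 x)) (hb : Tendsto b 𝒰 (𝓝 e)) (g : MvPolynomial (Fin n) ℝ) :
    Tendsto (fun y => secondDeriv g (a y) (b y) (b y)) 𝒰 (𝓝 (secondDeriv g x e e)) := by
  simp only [secondDeriv]
  exact tendsto_finsetSum _ fun m _ => (((continuous_apply m).tendsto e).comp hb).mul
    (tendsto_finsetSum _ fun l _ => (((continuous_apply l).tendsto e).comp hb).mul
      (((MvPolynomial.continuous_eval (pderiv m (pderiv l g))).tendsto x).comp ha))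

/-- Points `y ≠ x` accumulating at `x` have a limiting direction `e`. It is tangent to all
polynomials constant on these points, and a direction of nonpositive curvature for all polynomials
with critical point `x` which are smaller at these points than at `x`. -/
theorem exists_limit_direction {x : Fin n → ℝ} {Q : (Fin n → ℝ) → Prop}
    (h : ∃ᶠ y in 𝓝[≠] x, Q y) :
    ∃ e : Fin n → ℝ, e ≠ 0 ∧
      (∀ g, (∀ y, Q y → eval y g = eval x g) → gradient g x e = 0) ∧
      (∀ g, gradient g x = 0 → (∀ y, Q y → eval y g < eval x g) → secondDeriv g x e e ≤ 0) := by
  have hne : (𝓝[≠] x ⊓ 𝓟 {y | Q y}).NeBot := frequently_mem_iff_neBot.mp h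
  -- An ultrafilter replaces the choice of a subsequence: by compactness of the unit sphere the
  -- normalized directions `b y` converge along it.
  let 𝒰 := Ultrafilter.of (𝓝[≠] x ⊓ 𝓟 {y | Q y})
  have h𝒰 : (𝒰 : Filter (Fin n → ℝ)) ≤ 𝓝[≠] x ⊓ 𝓟 {y | Q y} := Ultrafilter.of_le _
  have hQ : ∀ᶠ y in 𝒰, Q y := (h𝒰.trans inf_le_right) (mem_principal_self _)
  have hyx : ∀ᶠ y in 𝒰, y ≠ x := (h𝒰.trans inf_le_left) self_mem_nhdsWithin
  have hlim : Tendsto (fun y => y) (𝒰 : Filter (Fin n → ℝ)) (𝓝 x) :=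
    (h𝒰.trans inf_le_left).trans nhdsWithin_le_nhds
  let b : (Fin n → ℝ) → Fin n → ℝ := fun y => ‖y - x‖⁻¹ • (y - x)
  have hb : ∀ᶠ y in 𝒰, b y ∈ Metric.sphere (0 : Fin n → ℝ) 1 := hyx.mono fun y hy => by
    have : ‖y - x‖ ≠ 0 := norm_ne_zero_iff.mpr (sub_ne_zero.mpr hy)
    simp [b, norm_smul, this]
  obtain ⟨e, he, hbe⟩ := (isCompact_sphere (0 : Fin n → ℝ) 1).ultrafilter_le_nhds (𝒰.map b)
    (le_principal_iff.mpr hb)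
  have hbe' : Tendsto b 𝒰 (𝓝 e) := hbe
  -- The intermediate points given by the mean value theorem also tend to `x`.
  have hseg : ∀ t : (Fin n → ℝ) → ℝ, (∀ᶠ y in 𝒰, t y ∈ Set.Ioo (0 : ℝ) 1) →
      Tendsto (fun y => x + t y • (y - x)) 𝒰 (𝓝 x) := fun t ht => by
    rw [tendsto_iff_norm_sub_tendsto_zero] at hlim ⊢
    refine squeeze_zero' (Eventually.of_forall fun _ => norm_nonneg _) (ht.mono fun y hy => ?_) hlim
    rw [add_sub_cancel_left, norm_smul, Real.norm_eq_abs, abs_of_pos hy.1]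
    exact mul_le_of_le_one_left (norm_nonneg _) hy.2.le
  refine ⟨e, ?_, fun g hg => ?_, fun g hg0 hg => ?_⟩
  · rintro rfl
    simp at he
  · have hex : ∀ y, ∃ t, Q y → t ∈ Set.Ioo (0 : ℝ) 1 ∧
        gradient g (x + t • (y - x)) (y - x) = 0 := fun y => by
      by_cases hy : Q y
      · obtain ⟨t, ht, h1⟩ := exists_gradient_eq_zero (hg y hy)
        exact ⟨t, fun _ => ⟨ht, h1⟩⟩
      · exact ⟨0, fun h => absurd h hy⟩
    choose t ht using hex
    have h1 := tendsto_gradient (hseg t (hQ.mono fun y hy => (ht y hy).1)) hbe' g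
    refine tendsto_nhds_unique h1 (tendsto_const_nhds.congr' (hQ.mono fun y hy => ?_))
    simp [b, (ht y hy).2]
  · have hex : ∀ y, ∃ t, Q y → t ∈ Set.Ioo (0 : ℝ) 1 ∧
        secondDeriv g (x + t • (y - x)) (y - x) (y - x) < 0 := fun y => by
      by_cases hy : Q y
      · obtain ⟨t, ht, h1⟩ := exists_secondDeriv_neg hg0 (hg y hy)
        exact ⟨t, fun _ => ⟨ht, h1⟩⟩
      · exact ⟨0, fun h => absurd h hy⟩
    choose t ht using hex
    have h1 := tendsto_secondDeriv (hseg t (hQ.mono fun y hy => (ht y hy).1)) hbe' g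
    refine le_of_tendsto h1 (hQ.mono fun y hy => ?_)
    simp only [b, secondDeriv_smul]
    exact mul_nonpos_of_nonneg_of_nonpos (by positivity) (ht y hy).2.le

/-- Were `s` negative, the second derivative test would make `a` a local maximum too. Then `h` would
be locally constant and `s` zero. -/
theorem nonneg_of_isLocalMin_of_hasDerivAt {h r : ℝ → ℝ} {s a : ℝ}
    (hmin : IsLocalMin h a) (hh : ∀ᶠ t in 𝓝 a, HasDerivAt h (r t) t) (hr : HasDerivAt r s a) :
    0 ≤ s := by
  by_contra! hs
  have hra : r a = 0 := hmin.hasDerivAt_eq_zero hh.self_of_nhds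
  have hd : deriv (-h) =ᶠ[𝓝 a] -r := hh.mono fun t ht => ht.neg.deriv
  have hmax : IsLocalMin (-h) a := by
    refine isLocalMin_of_deriv_deriv_pos ?_ ?_ hh.self_of_nhds.continuousAt.neg
    · rw [hd.deriv_eq, hr.neg.deriv]
      linarith
    · rw [hd.self_of_nhds, Pi.neg_apply, hra, neg_zero]
  have hconst : ∀ᶠ t in 𝓝 a, h t = h a := by
    filter_upwards [hmin, hmax] with t h1 h2
    simp only [Pi.neg_apply, neg_le_neg_iff] at h2
    exact le_antisymm h2 h1
  have hr0 : r =ᶠ[𝓝 a] fun _ => 0 := by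
    filter_upwards [hh, eventually_eventually_nhds.mpr hconst] with t h1 h2
    have h3 : HasDerivAt (fun _ : ℝ => h a) (r t) t :=
      h1.congr_of_eventuallyEq (h2.mono fun _ h => h.symm)
    exact h3.unique (hasDerivAt_const t (h a))
  have := (hr.congr_of_eventuallyEq hr0.symm).unique (hasDerivAt_const a (0 : ℝ))
  exact hs.ne this

end PolyOpt

namespace PolyOpt

open MvPolynomial Filter

variable {n p : ℕ}
variable (F : Fin p → MvPolynomial (Fin n) ℝ) (G : MvPolynomial (Fin n) ℝ) (J : Fin p ↪o Fin n)

/-! ### The Hessian on the chart -/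

theorem gradient_eq_zero_iff {g : MvPolynomial (Fin n) ℝ} {x : Fin n → ℝ} :
    gradient g x = 0 ↔ ∀ l, eval x (pderiv l g) = 0 := by
  refine ⟨fun h l => ?_, fun h => ?_⟩
  · have := congrArg (fun φ : (Fin n → ℝ) →L[ℝ] ℝ => φ (Pi.single l 1)) h
    simpa [gradient_apply, Pi.single_apply] using this
  · simp [gradient, h]

/-- Terms differentiating the coefficients `v k` carry first derivatives of `g`, which vanish at
`x`. -/
theorem gradient_sum_mul_pderiv {g : MvPolynomial (Fin n) ℝ} {x : Fin n → ℝ}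
    (hg : gradient g x = 0) (v : Fin n → MvPolynomial (Fin n) ℝ) (u : Fin n → ℝ) :
    gradient (∑ k, v k * pderiv k g) x u = secondDeriv g x u fun k => eval x (v k) := by
  rw [gradient_eq_zero_iff] at hg
  simp [gradient_apply, secondDeriv, hg]

theorem secondDeriv_comm (g : MvPolynomial (Fin n) ℝ) (x u w : Fin n → ℝ) :
    secondDeriv g x u w = secondDeriv g x w u := by
  simp only [secondDeriv, Finset.mul_sum]
  rw [Finset.sum_comm]
  refine Finset.sum_congr rfl fun l _ => Finset.sum_congr rfl fun m _ => ?_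
  rw [pderiv_pderiv_comm]
  ring

theorem secondDeriv_sum {κ : Type*} [Fintype κ] (g : MvPolynomial (Fin n) ℝ) (x : Fin n → ℝ)
    (w : κ → ℝ) (E : κ → Fin n → ℝ) :
    secondDeriv g x (∑ i, w i • E i) (∑ i, w i • E i) =
      ∑ i, w i * ∑ l, secondDeriv g x (E i) (E l) * w l := by
  have h1 : ∀ u, secondDeriv g x (∑ i, w i • E i) u = ∑ i, w i * secondDeriv g x (E i) u := by
    intro u
    simp only [secondDeriv, Finset.sum_apply, Pi.smul_apply, smul_eq_mul, Finset.sum_mul]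
    rw [Finset.sum_comm]
    refine Finset.sum_congr rfl fun i _ => ?_
    rw [Finset.mul_sum]
    exact Finset.sum_congr rfl fun m _ => by rw [mul_assoc]
  rw [h1]
  refine Finset.sum_congr rfl fun i _ => ?_
  rw [secondDeriv_comm, h1]
  congr 1
  exact Finset.sum_congr rfl fun l _ => by rw [secondDeriv_comm, mul_comm]

/-- The polynomial multiple `Δ_J` of the `i`-th coordinate vector field. -/
noncomputable def polyField (i : Fin (n - p)) : Fin n → MvPolynomial (Fin n) ℝ :=
  tangentField (jacobian F) J (complSeq J i)

theorem sum_polyField_mul_pderiv (i : Fin (n - p)) (j : Fin p) :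
    ∑ k, polyField F J i k * pderiv k (F j) = 0 :=
  sum_tangentField_mul_row (jacobian F) J (complSeq J i) j

theorem eval_Δ (x : Fin n → ℝ) : eval x (Δ F J) = ((jacobianAt F x).submatrix id J).det := by
  rw [Δ, RingHom.map_det]; rfl

theorem coordField_eq {x : Fin n → ℝ} (hΔ : eval x (Δ F J) ≠ 0) (i : Fin (n - p)) :
    coordField F J i x = (eval x (Δ F J))⁻¹ • fun l => eval x (polyField F J i l) := by
  have h : (fun l => eval x (polyField F J i l)) =
      tangentField (jacobianAt F x) J (complSeq J i) :=
    funext fun l => map_tangentField (eval x) _ _ _ l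
  rw [h, coordField, tangentField, Matrix.inv_def, ← eval_Δ, Ring.inverse_eq_inv', smul_sub,
    Finset.smul_sum]
  congr 1
  · rw [← Pi.single_smul, smul_eq_mul, inv_mul_cancel₀ hΔ]
  · refine Finset.sum_congr rfl fun j _ => ?_
    rw [← Pi.single_smul, ← Pi.single_smul, Matrix.smul_mulVec, smul_eq_mul, mul_one]
    rfl

theorem coordField_complSeq (i l : Fin (n - p)) (x : Fin n → ℝ) :
    coordField F J i x (complSeq J l) = (Pi.single l 1 : Fin (n - p) → ℝ) i := by
  have h : ∀ j, complSeq J l ≠ J j := complSeq_ne J l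
  simp [coordField, Pi.single_apply, h, eq_comm (a := l)]

theorem gradient_coordField {x : Fin n → ℝ} (hΔ : eval x (Δ F J) ≠ 0) (i : Fin (n - p))
    (j : Fin p) : gradient (F j) x (coordField F J i x) = 0 := by
  rw [coordField_eq F J hΔ, map_smul, gradient_apply]
  have := congrArg (eval x) (sum_polyField_mul_pderiv F J i j)
  simp only [map_sum, map_mul, map_zero] at this
  rw [this, smul_zero]

/-- The difference of the two sides vanishes in the coordinates outside `J` and is killed by the
Jacobian of `F`. The invertible block of columns `J` then forces its other coordinates to vanish. -/
theorem eq_sum_coordField {x u : Fin n → ℝ} (hΔ : eval x (Δ F J) ≠ 0)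
    (hu : ∀ j, gradient (F j) x u = 0) :
    u = ∑ i, u (complSeq J i) • coordField F J i x := by
  rw [← sub_eq_zero]
  set r := u - ∑ i, u (complSeq J i) • coordField F J i x with hr
  have hrc : ∀ l, r (complSeq J l) = 0 := fun l => by
    simp [hr, coordField_complSeq, Pi.single_apply]
  have hrg : ∀ j, gradient (F j) x r = 0 := fun j => by
    simp [hr, hu, gradient_coordField F J hΔ]
  have hrJ : (fun j => r (J j)) = 0 := by
    refine Matrix.eq_zero_of_mulVec_eq_zero (eval_Δ F J x ▸ hΔ) (funext fun j => ?_)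
    have h1 := hrg j
    rw [gradient_apply, ← Fintype.sum_of_injective J J.injective
      (fun j' => r (J j') * eval x (pderiv (J j') (F j))) _ (fun l hl => ?_) fun _ => rfl] at h1
    · rw [Pi.zero_apply, ← h1]
      change ∑ j', eval x (pderiv (J j') (F j)) * r (J j') = _
      exact Finset.sum_congr rfl fun j' _ => mul_comm (eval x (pderiv (J j') (F j))) (r (J j'))
    · obtain ⟨j', rfl⟩ | ⟨i, rfl⟩ := exists_eq_or_eq_complSeq J l
      · exact absurd ⟨j', rfl⟩ hl
      · rw [hrc, zero_mul]
  funext l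
  obtain ⟨j', rfl⟩ | ⟨i, rfl⟩ := exists_eq_or_eq_complSeq J l
  · exact congrFun hrJ j'
  · exact hrc i

/-- The Lagrangian of `G` with multipliers `c`. -/
noncomputable def lagrangian (c : Fin p → ℝ) : MvPolynomial (Fin n) ℝ :=
  G - ∑ j, C (c j) * F j

theorem eval_lagrangian {x : Fin n → ℝ} (hF : ∀ j, eval x (F j) = 0) (c : Fin p → ℝ) :
    eval x (lagrangian F G c) = eval x G := by
  simp [lagrangian, hF]

theorem gradient_lagrangian {x : Fin n → ℝ} {c : Fin p → ℝ} (hc : IsMultiplier F G x c) :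
    gradient (lagrangian F G c) x = 0 := by
  rw [gradient_eq_zero_iff]
  intro l
  simp [lagrangian, hc l]

theorem sum_mul_pderiv_lagrangian {v : Fin n → MvPolynomial (Fin n) ℝ}
    (hv : ∀ j, ∑ k, v k * pderiv k (F j) = 0) (c : Fin p → ℝ) :
    ∑ k, v k * pderiv k (lagrangian F G c) = ∑ k, v k * pderiv k G := by
  simp only [lagrangian, map_sub, map_sum, pderiv_C_mul, mul_sub, Finset.sum_sub_distrib,
    Finset.mul_sum, sub_eq_self]
  rw [Finset.sum_comm]
  refine Finset.sum_eq_zero fun j _ => ?_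
  rw [← mul_zero (C (c j)), ← hv j, Finset.mul_sum]
  exact Finset.sum_congr rfl fun k _ => by ring

/-- A tangent field differentiates `G` and the Lagrangian alike, so near `x` the `l`-th coordinate
derivative of `G` is `Q / Δ_J`. As `Q` vanishes at `x`, only its own derivative survives, and it is
a pure second derivative of the Lagrangian. -/
theorem hessian_apply {x : Fin n → ℝ} (hΔ : eval x (Δ F J) ≠ 0) {c : Fin p → ℝ}
    (hc : IsMultiplier F G x c) (i l : Fin (n - p)) :
    hessian F G J x i l =
      secondDeriv (lagrangian F G c) x (coordField F J i x) (coordField F J l x) := by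
  have hL := gradient_lagrangian F G hc
  set Q := ∑ k, polyField F J l k * pderiv k (lagrangian F G c) with hQ
  have hQx : eval x Q = 0 := by
    simp [hQ, gradient_eq_zero_iff.mp hL]
  have hev : (coordDeriv F J l fun y => eval y G) =ᶠ[𝓝 x]
      fun y => (eval y (Δ F J))⁻¹ * eval y Q := by
    filter_upwards [(MvPolynomial.continuous_eval (Δ F J)).continuousAt.eventually_ne hΔ] with y hy
    rw [coordDeriv, (hasFDerivAt_eval G y).fderiv, coordField_eq F J hy, map_smul, smul_eq_mul,
      gradient_apply, hQ, sum_mul_pderiv_lagrangian F G (sum_polyField_mul_pderiv F J l)]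
    simp
  have hinv : DifferentiableAt ℝ (fun y => (eval y (Δ F J))⁻¹) x :=
    (hasFDerivAt_eval (Δ F J) x).differentiableAt.inv hΔ
  have hder := hinv.hasFDerivAt.mul (hasFDerivAt_eval Q x)
  rw [hQx, zero_smul, add_zero] at hder
  have hval : hessian F G J x i l =
      fderiv ℝ (coordDeriv F J l fun y => eval y G) x (coordField F J i x) := rfl
  rw [hval, (hder.congr_of_eventuallyEq hev).fderiv, smul_apply, hQ,
    gradient_sum_mul_pderiv hL, coordField_eq F J hΔ l]
  have := secondDeriv_smul (lagrangian F G c) x (coordField F J i x)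
    (fun k => eval x (polyField F J l k)) 1 (eval x (Δ F J))⁻¹
  rw [one_smul, one_mul] at this
  rw [this, smul_eq_mul]

theorem isHermitian_hessian {x : Fin n → ℝ} (hΔ : eval x (Δ F J) ≠ 0) {c : Fin p → ℝ}
    (hc : IsMultiplier F G x c) : (hessian F G J x).IsHermitian := by
  ext i l
  rw [Matrix.conjTranspose_apply, star_trivial, hessian_apply F G J hΔ hc,
    hessian_apply F G J hΔ hc, secondDeriv_comm]

theorem dotProduct_hessian_mulVec {x : Fin n → ℝ} (hΔ : eval x (Δ F J) ≠ 0) {c : Fin p → ℝ}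
    (hc : IsMultiplier F G x c) (w : Fin (n - p) → ℝ) :
    dotProduct (star w) ((hessian F G J x).mulVec w) =
      secondDeriv (lagrangian F G c) x (∑ i, w i • coordField F J i x)
        (∑ i, w i • coordField F J i x) := by
  rw [secondDeriv_sum]
  simp only [dotProduct, Matrix.mulVec, star_trivial, hessian_apply F G J hΔ hc]

theorem posSemidef_hessian_of_isLocalMinOn {x : Fin n → ℝ}
    (hx : x ∈ realTrace (localized (zeroSet F) (Δ F J)))
    (hmin : IsLocalMinOn (fun y => eval y G) (realTrace (localized (zeroSet F) (Δ F J))) x) :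
    (hessian F G J x).PosSemidef := by
  obtain ⟨hF, hΔ⟩ := (mem_realTrace_chart F J).mp hx
  obtain ⟨c, hc⟩ := exists_isMultiplier_of_isLocalMinOn F G J hx hmin
  refine .of_dotProduct_mulVec_nonneg (isHermitian_hessian F G J hΔ hc) fun w => ?_
  rw [dotProduct_hessian_mulVec F G J hΔ hc]
  set u := ∑ i, w i • coordField F J i x with hu
  -- Multiplying by `Δ_J` makes the field polynomial; its value at `x` is `Δ_J(x) • u`. The second
  -- derivative along its integral curve is then the wanted form times `Δ_J(x)²`.
  let v : Fin n → MvPolynomial (Fin n) ℝ := fun k => ∑ i, C (w i) * polyField F J i k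
  have hvx : (fun k => eval x (v k)) = eval x (Δ F J) • u := by
    funext k
    simp only [v, map_sum, map_mul, eval_C, hu, Pi.smul_apply, Finset.sum_apply,
      coordField_eq F J hΔ, smul_eq_mul, Finset.mul_sum]
    exact Finset.sum_congr rfl fun i _ => by field_simp
  have hvF : ∀ j, ∑ k, v k * pderiv k (F j) = 0 := fun j => by
    simp only [v, Finset.sum_mul]
    rw [Finset.sum_comm]
    refine Finset.sum_eq_zero fun i _ => ?_
    rw [← mul_zero (C (w i)), ← sum_polyField_mul_pderiv F J i j, Finset.mul_sum]
    exact Finset.sum_congr rfl fun k _ => mul_assoc _ _ _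
  obtain ⟨γ, h0, ε, hε, hγ⟩ := exists_integralCurve v x
  have hmem0 : (0 : ℝ) ∈ Set.Ioo (-ε) ε := ⟨by linarith, hε⟩
  have hIoo : Set.Ioo (-ε) ε ∈ 𝓝 (0 : ℝ) := isOpen_Ioo.mem_nhds hmem0
  -- Tangency holds identically, so each `F j` is constant along the curve, which therefore stays in
  -- `V`.
  have hγF : ∀ t ∈ Set.Ioo (-ε) ε, ∀ j, eval (γ t) (F j) = 0 := fun t ht j => by
    have hd : ∀ t ∈ Set.Ioo (-ε) ε, HasDerivAt (fun s => eval (γ s) (F j)) 0 t := fun t ht => by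
      convert hasDerivAt_eval_comp (hγ t ht) (F j) using 1
      have := congrArg (eval (γ t)) (hvF j)
      simpa only [map_sum, map_mul, map_zero] using this.symm
    have := isOpen_Ioo.is_const_of_deriv_eq_zero isPreconnected_Ioo
      (fun t ht => (hd t ht).differentiableAt.differentiableWithinAt)
      (fun t ht => (hd t ht).deriv) ht hmem0
    simpa only [h0, hF] using this
  have hγ0 : Tendsto γ (𝓝 0) (𝓝 x) := by
    have := (hγ 0 hmem0).continuousAt.tendsto
    rwa [h0] at this
  have htend : Tendsto γ (𝓝 0) (𝓝[realTrace (localized (zeroSet F) (Δ F J))] x) := by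
    rw [nhdsWithin_chart F J hΔ]
    exact tendsto_nhdsWithin_iff.mpr ⟨hγ0, mem_of_superset hIoo fun t ht => hγF t ht⟩
  have hlocal : IsLocalMin (fun t => eval (γ t) (lagrangian F G c)) 0 := by
    filter_upwards [htend.eventually hmin, hIoo] with t h1 h2
    rw [eval_lagrangian F G (hγF t h2), h0, eval_lagrangian F G hF]
    exact h1
  set R := ∑ k, v k * pderiv k (lagrangian F G c) with hR
  have h1 : ∀ᶠ t in 𝓝 (0 : ℝ), HasDerivAt (fun t => eval (γ t) (lagrangian F G c))
      (eval (γ t) R) t := mem_of_superset hIoo fun t ht => by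
    have := hasDerivAt_eval_comp (hγ t ht) (lagrangian F G c)
    simpa [hR] using this
  have h2 := hasDerivAt_eval_comp (hγ 0 hmem0) R
  rw [← gradient_apply, h0, hR, gradient_sum_mul_pderiv (gradient_lagrangian F G hc), hvx,
    secondDeriv_smul] at h2
  exact nonneg_of_mul_nonneg_right (nonneg_of_isLocalMin_of_hasDerivAt hlocal h1 h2)
    (mul_self_pos.mpr hΔ)

/-- Otherwise points of `V` with smaller `G` accumulate at `x`. Their limiting direction is tangent
and nonzero, with nonpositive curvature of the Lagrangian, against definiteness. -/
theorem isLocalMinOn_of_posDef_hessian {x : Fin n → ℝ}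
    (hx : x ∈ realTrace (localized (zeroSet F) (Δ F J))) {c : Fin p → ℝ}
    (hc : IsMultiplier F G x c) (hpos : (hessian F G J x).PosDef) :
    IsLocalMinOn (fun y => eval y G) (realTrace (localized (zeroSet F) (Δ F J))) x := by
  obtain ⟨hF, hΔ⟩ := (mem_realTrace_chart F J).mp hx
  by_contra hnot
  rw [IsLocalMinOn, IsMinFilter, nhdsWithin_chart F J hΔ, not_eventually,
    frequently_nhdsWithin_iff] at hnot
  have hfreq : ∃ᶠ y in 𝓝[≠] x, eval y G < eval x G ∧ ∀ j, eval y (F j) = 0 := by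
    rw [frequently_nhdsWithin_iff]
    refine hnot.mono fun y hy => ⟨⟨not_le.mp hy.1, hy.2⟩, ?_⟩
    rintro rfl
    exact hy.1 le_rfl
  obtain ⟨e, he0, he1, he2⟩ := exists_limit_direction hfreq
  have heF : ∀ j, gradient (F j) x e = 0 := fun j => he1 _ fun y hy => by rw [hy.2, hF]
  have heL := he2 (lagrangian F G c) (gradient_lagrangian F G hc) fun y hy => by
    rw [eval_lagrangian F G hy.2, eval_lagrangian F G hF]
    exact hy.1
  have hsum := eq_sum_coordField F J hΔ heF
  have hw : (fun i => e (complSeq J i)) ≠ 0 := by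
    intro h
    apply he0
    rw [hsum]
    exact Finset.sum_eq_zero fun i _ => by rw [show e (complSeq J i) = 0 from congrFun h i, zero_smul]
  have h1 := hpos.dotProduct_mulVec_pos hw
  rw [dotProduct_hessian_mulVec F G J hΔ hc, ← hsum] at h1
  exact absurd heL (not_le.mpr h1)

/-- A point at which a family of `n` polynomials is regular is an isolated point of its fiber. -/
theorem eventually_eq_of_isRegularAt {ι : Type*} [Fintype ι] {f : ι → MvPolynomial (Fin n) ℝ}
    (hcard : Fintype.card ι = n) {x : Fin n → ℝ} (hreg : IsRegularAt f x) :
    ∀ᶠ y in 𝓝 x, (∀ i, eval y (f i) = eval x (f i)) → y = x := by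
  by_contra hnot
  have hfreq : ∃ᶠ y in 𝓝[≠] x, ∀ i, eval y (f i) = eval x (f i) := by
    rw [frequently_nhdsWithin_iff]
    rw [not_eventually] at hnot
    exact hnot.mono fun y hy => by simpa using hy
  obtain ⟨e, he0, he1, -⟩ := exists_limit_direction hfreq
  -- Full rank `n` leaves no kernel for a limiting direction of further points of the fiber.
  have hker : LinearMap.ker (jacobianAt f x).mulVecLin = ⊥ := by
    rw [← Submodule.finrank_eq_zero (R := ℝ)]
    have h1 := LinearMap.finrank_range_add_finrank_ker (jacobianAt f x).mulVecLin
    have h2 : Module.finrank ℝ (LinearMap.range (jacobianAt f x).mulVecLin) = Fintype.card ι := hreg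
    rw [Module.finrank_fin_fun] at h1
    omega
  refine he0 ((Submodule.eq_bot_iff _).mp hker e ?_)
  ext i
  have := he1 (f i) fun y hy => hy i
  rw [gradient_apply] at this
  rw [Pi.zero_apply, ← this]
  change ∑ l, eval x (pderiv l (f i)) * e l = _
  exact Finset.sum_congr rfl fun l _ => mul_comm (eval x (pderiv l (f i))) (e l)

theorem isRegularAt_of_isIsolatedLocalMinOn
    (hreg : ∀ x ∈ realTrace (zeroSet F), IsRegularAt F x) (hB : ConditionB F G) {x : Fin n → ℝ}
    (hx : IsIsolatedLocalMinOn (fun y => eval y G)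
      (realTrace (localized (zeroSet F) (Δ F J))) x) :
    IsRegularAt (withMinors F G J (n - p) le_rfl) x := by
  obtain ⟨hF, hΔ⟩ := (mem_realTrace_chart F J).mp hx.1
  obtain hpn | hpn := Nat.eq_zero_or_pos (n - p)
  · have : IsEmpty (Fin (n - p)) := by rw [hpn]; infer_instance
    exact isRegularAt_sumElim_of_isEmpty _ (hreg x hx.1.1)
  obtain ⟨c, hc⟩ := exists_isMultiplier_of_isLocalMinOn F G J hx.1 hx.2.1
  refine (hB J (n - p) le_rfl hpn).1 x
    ⟨⟨?_, hx.1.2⟩, not_mem_D_of_isIsolatedLocalMinOn F G J hB hpn hx⟩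
  rintro (j | i)
  · exact hx.1.1 j
  · exact aeval_M_eq_zero_of_mem_criticalSet F G J (mem_criticalSet_of_isMultiplier F G hF hc) _

end PolyOpt
-- The two inclusions
theorem lemma3 (n p : ℕ) (hp : 1 ≤ p) (hpn : p ≤ n)
    (F : Fin p → MvPolynomial (Fin n) ℝ) (G : MvPolynomial (Fin n) ℝ)
    (hne : (PolyOpt.realTrace (PolyOpt.zeroSet F)).Nonempty)
    (hreg : ∀ x ∈ PolyOpt.realTrace (PolyOpt.zeroSet F), PolyOpt.IsRegularAt F x)
    (hB : PolyOpt.ConditionB F G) (hC : PolyOpt.ConditionC F G)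
    (J : Fin p ↪o Fin n) :
    {x : Fin n → ℝ | PolyOpt.IsIsolatedLocalMinOn (fun y => MvPolynomial.eval y G)
        (PolyOpt.realTrace (PolyOpt.localized (PolyOpt.zeroSet F) (PolyOpt.Δ F J))) x} =
      {x : Fin n → ℝ |
        x ∈ PolyOpt.realTrace
          (PolyOpt.localized (PolyOpt.criticalSet F G) (PolyOpt.Δ F J)) ∧
        PolyOpt.IsRegularAt (PolyOpt.withMinors F G J (n - p) le_rfl) x ∧
        (PolyOpt.hessian F G J x).PosDef} 
:= by
  ext x
  constructor
  · intro hx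
    obtain ⟨hF, hΔ⟩ := (PolyOpt.mem_realTrace_chart F J).mp hx.1
    obtain ⟨c, hc⟩ := PolyOpt.exists_isMultiplier_of_isLocalMinOn F G J hx.1 hx.2.1
    have hW := PolyOpt.mem_criticalSet_of_isMultiplier F G hF hc
    have hr := PolyOpt.isRegularAt_of_isIsolatedLocalMinOn F G J hreg hB hx
    have hxW : x ∈ PolyOpt.realTrace
        (PolyOpt.localized (PolyOpt.criticalSet F G) (PolyOpt.Δ F J)) := ⟨hW, hx.1.2⟩
    -- Positive semidefinite with nonzero determinant is positive definite; Condition C supplies the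
    -- determinant.
    exact ⟨hxW, hr, (PolyOpt.posSemidef_hessian_of_isLocalMinOn F G J hx.1
      hx.2.1).posDef_iff_det_ne_zero.mpr (hC J x hxW hr)⟩
  · rintro ⟨hxW, hr, hpos⟩
    have hx : x ∈ PolyOpt.realTrace (PolyOpt.localized (PolyOpt.zeroSet F) (PolyOpt.Δ F J)) :=
      ⟨hxW.1.1, hxW.2⟩
    obtain ⟨hF, hΔ⟩ := (PolyOpt.mem_realTrace_chart F J).mp hx
    obtain ⟨c, hc⟩ := PolyOpt.exists_isMultiplier_of_mem_criticalSet F G J hΔ hxW.1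
    refine ⟨hx, PolyOpt.isLocalMinOn_of_posDef_hessian F G J hx hc hpos, ?_⟩
    -- The family has `p + (n - p) = n` members. Any local minimum near `x` is critical, hence lies
    -- in the same fiber as `x`, namely the common zeros.
    have hiso := PolyOpt.eventually_eq_of_isRegularAt (by simp; omega) hr
    filter_upwards [mem_nhdsWithin_of_mem_nhds hiso, self_mem_nhdsWithin] with y hy hyS hymin
    obtain ⟨b, hb⟩ := PolyOpt.exists_isMultiplier_of_isLocalMinOn F G J hyS hymin
    have hyF := ((PolyOpt.mem_realTrace_chart F J).mp hyS).1
    refine hy ?_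
    rintro (j | i)
    · exact (hyF j).trans (hF j).symm
    · exact (PolyOpt.M_eq_zero_of_isMultiplier F G J hyF hb _).trans
        (PolyOpt.M_eq_zero_of_isMultiplier F G J hF hc _).symm
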